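/- **Setting.** Consider a sequence of linear models $y=X\beta^*+\varepsilon$ (the index of the sequence is suppressed) with sample size $N\to\infty$, dimension $n\ge 2$, $X\in\mathbb{R}^{N\times n}$, $\beta^*\in\mathbb{R}^n$, and a graph $\mathcal G$ with vertex set $[n]$ and maximum degree $d$; $n$, $\mathcal G$, $\beta^*$ and all quantities below may vary along the sequence unless they are called constants. Let $F$ be the oriented incidence matrix of $\mathcal G$ (the row of the edge $(i,j)$, $i<j$, has $-1$ in entry $i$, $+1$ in entry $j$, and zeros elsewhere), $L=F^TF$, and for a fixed integer $k\ge 0$ let $\Delta^{(k+1)}=L^{(k+1)/2}$ if $k$ is odd and $\Delta^{(k+1)}=FL^{k/2}$ if $k$ is even. Let $s_1,s_2>0$ and assume $\|\Delta^{(k+1)}\beta^*\|_0\le s_1$ and $\|\beta^*\|_0\le s_2$, where $\|\cdot\|_0$ counts nonzero entries. The rows of $X$ are i.i.d. $\sigma_x$-sub-Gaussian random vectors with covariance matrix $\Sigma_x$: they have mean zero, and $\mathbb{E}\,e^{t\,u^TX_i}\le e^{\sigma_x^2t^2/2}$ for all $t\in\mathbb{R}$ and all Euclidean unit vectors $u$.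 All eigenvalues of $\Sigma_x$ lie in $[c,c']$, where $\sigma_x,c,c'>0$ are constants. Put $\Theta_x=\Sigma_x^{-1}$ and assume $\max_a\sum_b|(\Theta_x)_{ab}|\le M_n$. The noise satisfies $\varepsilon\sim N(0,\sigma_\varepsilon^2I_N)$ with $\sigma_\varepsilon>0$ and is independent of $X$. **Estimators.** Let $\Sigma_N=\frac1N X^TX$, let $$\hat\beta\in\arg\min_{\beta\in\mathbb{R}^n}\ \frac1{2N}\|y-X\beta\|_2^2+\lambda_g\|\Delta^{(k+1)}\beta\|_1+\lambda\|\beta\|_1 ,$$ and let $\widehat\Theta$, a measurable function of $X$, be a minimizer of $\sum_{a,b}|\Theta_{ab}|$ over all $\Theta\in\mathbb{R}^{n\times n}$ with $\max_{a,b}|(\Theta\Sigma_N-I_n)_{ab}|\le\mu$ (an arbitrary value is taken when no such $\Theta$ exists). Let $$\tilde\beta=\hat\beta+\frac1N\widehat\Theta X^T(y-X\hat\beta),\qquad \hat\sigma_\varepsilon=\sqrt{\frac1N\sum_{i=1}^N\left(y_i-X_i^T\hat\beta\right)^2}.$$ **Statement.** There are constants $c_\lambda,c_\mu>0$, depending only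 on $\sigma_x,c,c'$, such that the following holds. Let $\lambda\asymp\sigma_\varepsilon\sqrt{\log n/N}$ and $\mu\asymp\sqrt{\log n/N}$ with sufficiently large constants, that is, for some constants $C_\lambda,C_\mu$, $$c_\lambda\,\sigma_\varepsilon\sqrt{\tfrac{\log n}{N}}\le\lambda\le C_\lambda\,\sigma_\varepsilon\sqrt{\tfrac{\log n}{N}},\qquad c_\mu\sqrt{\tfrac{\log n}{N}}\le\mu\le C_\mu\sqrt{\tfrac{\log n}{N}},$$ and let $\lambda_g=\lambda\sqrt{\nu/(2d)^{k+1}}$ for a constant $0\le\nu<1$ (with $\lambda_g=0$ if $d=0$). Assume $$\frac{s_2}{s_1}\ge\nu,\qquad \frac{s_2\log n}{\sqrt N}\to0,\qquad M_n\sqrt{\frac{\log n}{N}}\to0 .$$ Then for every choice of coordinates $j\in[n]$ (which may vary along the sequence), $$\frac{\sqrt N\,(\tilde\beta_j-\beta_j^*)}{\hat\sigma_\varepsilon\sqrt{e_j^T\widehat\Theta\,\Sigma_N\widehat\Theta^Te_j}}\ \longrightarrow\ N(0,1)\quad\text{in distribution}.$$ -/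

import Mathlib

open MeasureTheory ProbabilityTheory Filter Topology Matrix

namespace GraphLasso

noncomputable section

/-! Graph difference operators on a graph with vertex set `Fin n`. -/

/-- The edges of `G`, each written as `(i, j)` with `i < j`. -/
abbrev Edge {n : ℕ} (G : SimpleGraph (Fin n)) : Type :=
  {p : Fin n × Fin n // p.1 < p.2 ∧ G.Adj p.1 p.2}

instance edgeFintype {n : ℕ} (G : SimpleGraph (Fin n)) : Fintype (Edge G) := by
  classical
  infer_instance

/-- The oriented incidence matrix `F`: the row of the edge `(i, j)`, `i < j`, has `-1` in entry
`i`, `+1` in entry `j`, and zeros elsewhere. -/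
def incidence {n : ℕ} (G : SimpleGraph (Fin n)) : Matrix (Edge G) (Fin n) ℝ :=
  fun e v => if v = e.1.1 then -1 else if v = e.1.2 then 1 else 0

/-- The Laplacian matrix `L = FᵀF`. -/
def laplacian {n : ℕ} (G : SimpleGraph (Fin n)) : Matrix (Fin n) (Fin n) ℝ :=
  (incidence G)ᵀ * incidence G

/-- Row index type of a graph difference operator: the vertices if the flag `odd` is `true`,
the edges if it is `false`. -/
def DiffRow {n : ℕ} (G : SimpleGraph (Fin n)) : (odd : Bool) → Type
  | true => Fin n
  | false => Edge G

instance diffRowFintype {n : ℕ} (G : SimpleGraph (Fin n)) :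
    (odd : Bool) → Fintype (DiffRow G odd)
  | true => inferInstanceAs (Fintype (Fin n))
  | false => inferInstanceAs (Fintype (Edge G))

/-- `L ^ ((k + 1) / 2)` for the flag `true`, and `F * L ^ (k / 2)` for the flag `false`. -/
def diffMatrix {n : ℕ} (G : SimpleGraph (Fin n)) (k : ℕ) :
    (odd : Bool) → Matrix (DiffRow G odd) (Fin n) ℝ
  | true => (laplacian G ^ ((k + 1) / 2) : Matrix (Fin n) (Fin n) ℝ)
  | false => (incidence G * laplacian G ^ (k / 2) : Matrix (Edge G) (Fin n) ℝ)

/-- The graph difference operator `Δ^(k+1)` of order `k + 1`: it is `L ^ ((k + 1) / 2)` for odd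
`k` and `F * L ^ (k / 2)` for even `k`. -/
def graphDiff {n : ℕ} (G : SimpleGraph (Fin n)) (k : ℕ) :
    Matrix (DiffRow G (decide (Odd k))) (Fin n) ℝ :=
  diffMatrix G k (decide (Odd k))

/-- The maximum degree of the graph, as a real number. -/
def maxDeg {n : ℕ} (G : SimpleGraph (Fin n)) : ℝ := by
  classical
  exact (G.maxDegree : ℝ)

/-- The `ℓ₁`-norm of a vector. -/
def l1 {ι : Type} [Fintype ι] (v : ι → ℝ) : ℝ := ∑ i, |v i|

/-- The number of nonzero entries of a vector. -/
def l0 {ι : Type} (v : ι → ℝ) : ℕ := (Function.support v).ncard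

/-- The parameter space `S(k, s₁, s₂)`. -/
def paramSpace {n : ℕ} (G : SimpleGraph (Fin n)) (k : ℕ) (s₁ s₂ : ℝ) : Set (Fin n → ℝ) :=
  {b | (l0 (graphDiff G k *ᵥ b) : ℝ) ≤ s₁ ∧ (l0 b : ℝ) ≤ s₂}

/-! The random design and the noise. -/

/-- A real random variable is `σ`-sub-Gaussian: it has mean zero and
`E exp (t Y) ≤ exp (σ² t² / 2)` for all real `t`. -/
def IsSubGaussian {Ω : Type*} [MeasurableSpace Ω] (σ : ℝ) (Y : Ω → ℝ) (P : Measure Ω) : Prop :=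
  ∫ ω, Y ω ∂P = 0 ∧ HasSubgaussianMGF Y (Real.toNNReal (σ ^ 2)) P

/-- A random vector is `σ`-sub-Gaussian: it has mean zero and all its projections on Euclidean
unit vectors are `σ`-sub-Gaussian. -/
def IsSubGaussianVec {Ω : Type*} [MeasurableSpace Ω] {n : ℕ} (σ : ℝ) (Y : Ω → Fin n → ℝ)
    (P : Measure Ω) : Prop :=
  (∀ a, ∫ ω, Y ω a ∂P = 0) ∧
    ∀ u : Fin n → ℝ, ∑ a, u a ^ 2 = 1 → IsSubGaussian σ (fun ω => ∑ a, u a * Y ω a) P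

/-- `X` is a row-wise `(σ, S)`-sub-Gaussian random matrix: its rows are i.i.d., `σ`-sub-Gaussian,
with covariance matrix `S`. -/
structure IsSubGaussianDesign {Ω : Type*} [MeasurableSpace Ω] {N n : ℕ} (σ : ℝ)
    (S : Matrix (Fin n) (Fin n) ℝ) (X : Ω → Fin N → Fin n → ℝ) (P : Measure Ω) : Prop where
  measurable : Measurable X
  indep : iIndepFun (fun (i : Fin N) (ω : Ω) => X ω i) P
  ident : ∀ i i' : Fin N, IdentDistrib (fun ω => X ω i) (fun ω => X ω i') P P
  subGaussian : ∀ i : Fin N, IsSubGaussianVec σ (fun ω => X ω i) P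
  covariance : ∀ (i : Fin N) (a b : Fin n), cov[fun ω => X ω i a, fun ω => X ω i b; P] = S a b

/-- The noise vector is `N(0, σ² I_N)`: its components are i.i.d. `N(0, σ²)`. -/
structure IsGaussianNoise {Ω : Type*} [MeasurableSpace Ω] {N : ℕ} (σ : ℝ)
    (ε : Ω → Fin N → ℝ) (P : Measure Ω) : Prop where
  indep : iIndepFun (fun (i : Fin N) (ω : Ω) => ε ω i) P
  law : ∀ i : Fin N, HasLaw (fun ω => ε ω i) (gaussianReal 0 (Real.toNNReal (σ ^ 2))) P

/-! The estimators. -/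

/-- The response `y = X β + ε` of the linear model. -/
def response {N n : ℕ} (X : Matrix (Fin N) (Fin n) ℝ) (β : Fin n → ℝ) (ε : Fin N → ℝ) :
    Fin N → ℝ :=
  X *ᵥ β + ε

/-- The objective `(1 / (2N)) ‖y - X b‖₂² + λ_g ‖Δ^(k+1) b‖₁ + λ ‖b‖₁`. -/
def objective {N n : ℕ} (G : SimpleGraph (Fin n)) (k : ℕ) (lamg lam : ℝ)
    (X : Matrix (Fin N) (Fin n) ℝ) (y : Fin N → ℝ) (b : Fin n → ℝ) : ℝ :=
  1 / (2 * (N : ℝ)) * ∑ i, (y i - (X *ᵥ b) i) ^ 2 + lamg * l1 (graphDiff G k *ᵥ b) + lam * l1 b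

/-- `b` is a `k`-th order Graph-Piecewise-Polynomial-Lasso estimate, that is, a global minimizer
of the objective. -/
def IsGraphLasso {N n : ℕ} (G : SimpleGraph (Fin n)) (k : ℕ) (lamg lam : ℝ)
    (X : Matrix (Fin N) (Fin n) ℝ) (y : Fin N → ℝ) (b : Fin n → ℝ) : Prop :=
  ∀ b' : Fin n → ℝ, objective G k lamg lam X y b ≤ objective G k lamg lam X y b'

/-- `Σ_N = (1 / N) XᵀX`. -/
def sampleCov {N n : ℕ} (X : Matrix (Fin N) (Fin n) ℝ) : Matrix (Fin n) (Fin n) ℝ :=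
  (1 / (N : ℝ)) • (Xᵀ * X)

/-- The CLIME constraint: all entries of `Θ Σ_N - I` are at most `mu` in absolute value. -/
def ClimeFeasible {N n : ℕ} (X : Matrix (Fin N) (Fin n) ℝ) (mu : ℝ)
    (Θ : Matrix (Fin n) (Fin n) ℝ) : Prop :=
  ∀ a b, |(Θ * sampleCov X - 1) a b| ≤ mu

/-- `Θ` solves the CLIME program: it minimizes the elementwise `ℓ₁`-norm subject to the
constraint. -/
def IsClime {N n : ℕ} (X : Matrix (Fin N) (Fin n) ℝ) (mu : ℝ)
    (Θ : Matrix (Fin n) (Fin n) ℝ) : Prop :=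
  ClimeFeasible X mu Θ ∧
    ∀ Θ' : Matrix (Fin n) (Fin n) ℝ, ClimeFeasible X mu Θ' →
      ∑ a, ∑ b, |Θ a b| ≤ ∑ a, ∑ b, |Θ' a b|

/-- The one-step estimator `b + (1 / N) Θ Xᵀ (y - X b)`. -/
def oneStep {N n : ℕ} (X : Matrix (Fin N) (Fin n) ℝ) (y : Fin N → ℝ)
    (Θ : Matrix (Fin n) (Fin n) ℝ) (b : Fin n → ℝ) : Fin n → ℝ :=
  b + (1 / (N : ℝ)) • (Θ *ᵥ (Xᵀ *ᵥ (y - X *ᵥ b)))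

/-- The residual estimator of the noise standard deviation. -/
def residualStd {N n : ℕ} (X : Matrix (Fin N) (Fin n) ℝ) (y : Fin N → ℝ) (b : Fin n → ℝ) : ℝ :=
  √(1 / (N : ℝ) * ∑ i, (y i - (X *ᵥ b) i) ^ 2)

/-- The studentized statistic
`√N (β̃_j - β_j) / (σ̂ √(e_jᵀ Θ Σ_N Θᵀ e_j))` of the one-step estimator `β̃` built from the
initial estimate `b`, where `σ̂` is the residual estimator. -/
def studentized {N n : ℕ} (X : Matrix (Fin N) (Fin n) ℝ) (y : Fin N → ℝ)
    (Θ : Matrix (Fin n) (Fin n) ℝ) (b β : Fin n → ℝ) (j : Fin n) : ℝ :=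
  √(N : ℝ) * (oneStep X y Θ b j - β j) /
    (residualStd X y b * √((Θ * sampleCov X * Θᵀ) j j))

end

end GraphLasso

open GraphLasso

/-! The studentized statistic has the leading term `∑ i, w i * (ε i / σ)`, where `w` is the unit
vector in the direction of `X Θᵀ e_j`. Because `w` depends on the design only, which is independent
of the Gaussian noise, the leading term is exactly standard normal, and it remains to show that the
difference tends to zero in probability. On a good event the difference is controlled by the
`ℓ₁`-error and the prediction error of the penalized estimator. There the graph penalty is harmless:
as `‖F‖² ≤ 2d`, an error vector `v` gains at most `λ_g √s₁ (2d) ^ ((k + 1) / 2) ‖v‖₂` from it, and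
the choice of `λ_g` together with `ν s₁ ≤ s₂` bounds this by the term `λ √s₂ ‖v‖₂` that the
`ℓ₁`-penalty contributes anyway.

The thresholds for the tuning parameters must not depend on the failure probability, which at fixed
thresholds is a power of `1 / n`. For large `n` this is enough. If `n` is bounded in terms of the
failure probability, every vector counts as sparse at the level `s₂ + n`, so no lower bound on `λ`
is needed, and the sample covariance matrix is invertible, so its inverse is feasible. -/

namespace GraphLasso

section Subexponential

variable {Ω : Type*} [MeasurableSpace Ω] {P : Measure Ω}

/-- A real random variable is sub-exponential with variance proxy `c` on the radius `b`: its moment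
generating function is at most that of `N(0, c)` on `[-b, b]`. This is the local analogue of
`HasSubgaussianMGF`, and the hypothesis of Bernstein's inequality. -/
structure HasSubexponentialMGF (X : Ω → ℝ) (c b : ℝ) (P : Measure Ω) : Prop where
  integrable_exp_mul : ∀ t, |t| ≤ b → Integrable (fun ω => Real.exp (t * X ω)) P
  mgf_le : ∀ t, |t| ≤ b → mgf X P t ≤ Real.exp (c * t ^ 2 / 2)

namespace HasSubexponentialMGF

theorem neg {X : Ω → ℝ} {c b : ℝ} (h : HasSubexponentialMGF X c b P) :
    HasSubexponentialMGF (-X) c b P where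
  integrable_exp_mul t ht := by
    simpa using h.integrable_exp_mul (-t) (by rwa [abs_neg])
  mgf_le t ht := by
    simpa [mgf_neg] using h.mgf_le (-t) (by rwa [abs_neg])

theorem sum_of_iIndepFun {ι : Type*} {X : ι → Ω → ℝ} {c : ι → ℝ} {b : ℝ} (hind : iIndepFun X P)
    (hX : ∀ i, AEMeasurable (X i) P) {s : Finset ι}
    (h : ∀ i ∈ s, HasSubexponentialMGF (X i) (c i) b P) :
    HasSubexponentialMGF (∑ i ∈ s, X i) (∑ i ∈ s, c i) b P where
  integrable_exp_mul t ht := by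
    have := hind.isProbabilityMeasure
    rw [← mgf_pos_iff, hind.mgf_sum₀ hX]
    exact Finset.prod_pos fun i hi => mgf_pos ((h i hi).integrable_exp_mul t ht)
  mgf_le t ht := by
    rw [hind.mgf_sum₀ hX, Finset.sum_mul, Finset.sum_div, Real.exp_sum]
    exact Finset.prod_le_prod (fun _ _ => mgf_nonneg) fun i hi => (h i hi).mgf_le t ht

theorem measureReal_ge_le [IsFiniteMeasure P] {X : Ω → ℝ} {c b u : ℝ}
    (h : HasSubexponentialMGF X c b P) (hc : 0 < c) (hu : 0 ≤ u) (hub : u ≤ b * c) :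
    P.real {ω | u ≤ X ω} ≤ Real.exp (-(u ^ 2 / (2 * c))) := by
  have hub' : |u / c| ≤ b := by
    rwa [abs_of_nonneg (by positivity), div_le_iff₀ hc]
  calc P.real {ω | u ≤ X ω} ≤ Real.exp (-(u / c) * u) * mgf X P (u / c) :=
        measure_ge_le_exp_mul_mgf u (by positivity) (h.integrable_exp_mul _ hub')
    _ ≤ Real.exp (-(u / c) * u) * Real.exp (c * (u / c) ^ 2 / 2) := by
        gcongr
        exact h.mgf_le _ hub'
    _ = Real.exp (-(u ^ 2 / (2 * c))) := by
        rw [← Real.exp_add]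
        congr 1
        field

theorem measureReal_abs_ge_le [IsFiniteMeasure P] {X : Ω → ℝ} {c b u : ℝ}
    (h : HasSubexponentialMGF X c b P) (hc : 0 < c) (hu : 0 ≤ u) (hub : u ≤ b * c) :
    P.real {ω | u ≤ |X ω|} ≤ 2 * Real.exp (-(u ^ 2 / (2 * c))) := by
  have hsplit : {ω | u ≤ |X ω|} = {ω | u ≤ X ω} ∪ {ω | u ≤ (-X) ω} := by
    ext ω
    exact le_abs (a := u) (b := X ω)
  calc P.real {ω | u ≤ |X ω|} ≤ P.real {ω | u ≤ X ω} + P.real {ω | u ≤ (-X) ω} :=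
        hsplit ▸ measureReal_union_le _ _
    _ ≤ 2 * Real.exp (-(u ^ 2 / (2 * c))) := by
        linarith [h.measureReal_ge_le hc hu hub, h.neg.measureReal_ge_le hc hu hub]

/-- **Bernstein's inequality** for averages. -/
theorem measureReal_abs_average_ge_le {N : ℕ} (hN : 0 < N) {X : Fin N → Ω → ℝ}
    (hind : iIndepFun X P) (hX : ∀ i, AEMeasurable (X i) P) {c b u : ℝ}
    (h : ∀ i, HasSubexponentialMGF (X i) c b P) (hc : 0 < c) (hu : 0 ≤ u) (hub : u ≤ b * c) :
    P.real {ω | u ≤ |1 / (N : ℝ) * ∑ i, X i ω|} ≤ 2 * Real.exp (-(N * u ^ 2 / (2 * c))) := by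
  have := hind.isProbabilityMeasure
  have hsum := sum_of_iIndepFun hind hX (s := Finset.univ) fun i _ => h i
  simp only [Finset.sum_const, Finset.card_univ, Fintype.card_fin, nsmul_eq_mul] at hsum
  have hscale : {ω | u ≤ |1 / (N : ℝ) * ∑ i, X i ω|} = {ω | N * u ≤ |(∑ i, X i) ω|} := by
    ext ω
    rw [Set.mem_ofPred_eq, Set.mem_ofPred_eq, abs_mul, abs_of_pos (by positivity), Finset.sum_apply,
      one_div_mul_eq_div, le_div_iff₀' (by positivity)]
  rw [hscale]
  refine (hsum.measureReal_abs_ge_le (by positivity) (by positivity) ?_).trans_eq ?_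
  · rw [mul_left_comm]
    gcongr
  · congr 3
    field

end HasSubexponentialMGF

theorem exp_le_one_add_add_sq_mul_exp_abs (x : ℝ) :
    Real.exp x ≤ 1 + x + x ^ 2 * Real.exp |x| := by
  have hone : 1 ≤ Real.exp |x| := Real.one_le_exp (abs_nonneg x)
  rcases le_total |x| 1 with h | h
  · have hquad := (abs_le.1 (Real.abs_exp_sub_one_sub_id_le h)).2
    nlinarith [sq_nonneg x]
  · have hsq : 1 ≤ x ^ 2 := by rw [← sq_abs]; exact one_le_pow₀ h
    rcases le_total 0 x with hx | hx
    · rw [abs_of_nonneg hx] at *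
      nlinarith
    · rw [abs_of_nonpos hx] at *
      nlinarith [Real.exp_le_one_iff.2 hx]

theorem sq_mul_exp_abs_le {a t x : ℝ} (ha : 0 < a) (ht : |t| ≤ a / 2) :
    (t * x) ^ 2 * Real.exp |t * x| ≤ 8 / a ^ 2 * t ^ 2 * Real.exp (a * |x|) := by
  have hexp : |t * x| ≤ a * |x| / 2 := by
    rw [abs_mul]
    nlinarith [abs_nonneg x]
  have hquad : x ^ 2 ≤ 8 / a ^ 2 * Real.exp (a * |x| / 2) := by
    have := Real.quadratic_le_exp_of_nonneg (x := a * |x| / 2) (by positivity)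
    rw [div_mul_eq_mul_div, le_div_iff₀ (by positivity)]
    nlinarith [sq_abs x, mul_nonneg ha.le (abs_nonneg x)]
  calc (t * x) ^ 2 * Real.exp |t * x|
      ≤ t ^ 2 * (8 / a ^ 2 * Real.exp (a * |x| / 2)) * Real.exp (a * |x| / 2) := by
        rw [mul_pow]
        gcongr
    _ = 8 / a ^ 2 * t ^ 2 * (Real.exp (a * |x| / 2) * Real.exp (a * |x| / 2)) := by ring
    _ = 8 / a ^ 2 * t ^ 2 * Real.exp (a * |x|) := by rw [← Real.exp_add, add_halves]

theorem integrable_of_integrable_exp_mul_abs {W : Ω → ℝ} {a : ℝ} (ha : 0 < a)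
    (hW : AEStronglyMeasurable W P) (hint : Integrable (fun ω => Real.exp (a * |W ω|)) P) :
    Integrable W P := by
  refine (hint.const_mul a⁻¹).mono' hW (Eventually.of_forall fun ω => ?_)
  rw [Real.norm_eq_abs, ← div_eq_inv_mul, le_div_iff₀' ha]
  linarith [Real.add_one_le_exp (a * |W ω|)]

theorem integrable_exp_mul_of_integrable_exp_mul_abs {W : Ω → ℝ} {a t : ℝ} (hta : |t| ≤ a)
    (hW : AEMeasurable W P) (hint : Integrable (fun ω => Real.exp (a * |W ω|)) P) :
    Integrable (fun ω => Real.exp (t * W ω)) P := by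
  refine hint.mono' (by fun_prop) (Eventually.of_forall fun ω => ?_)
  rw [Real.norm_eq_abs, Real.abs_exp, Real.exp_le_exp]
  calc t * W ω ≤ |t * W ω| := le_abs_self _
    _ ≤ a * |W ω| := by rw [abs_mul]; gcongr

theorem hasSubexponentialMGF_sub_integral [IsProbabilityMeasure P] {W : Ω → ℝ} {a K : ℝ}
    (ha : 0 < a) (hW : AEMeasurable W P) (hint : Integrable (fun ω => Real.exp (a * |W ω|)) P)
    (hK : ∫ ω, Real.exp (a * |W ω|) ∂P ≤ K) :
    HasSubexponentialMGF (fun ω => W ω - P[W]) (16 * K / a ^ 2) (a / 2) P := by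
  have hWint := integrable_of_integrable_exp_mul_abs ha hW.aestronglyMeasurable hint
  have hexp : ∀ t, |t| ≤ a / 2 → Integrable (fun ω => Real.exp (t * W ω)) P := fun t ht =>
    integrable_exp_mul_of_integrable_exp_mul_abs (by linarith) hW hint
  have hcenter : ∀ t ω, Real.exp (t * (W ω - P[W]))
      = Real.exp (-(t * P[W])) * Real.exp (t * W ω) := fun t ω => by
    rw [← Real.exp_add]
    ring_nf
  refine ⟨fun t ht => by simpa only [hcenter] using (hexp t ht).const_mul _, fun t ht => ?_⟩
  have hlin : Integrable (fun ω => 1 + t * W ω) P := (integrable_const 1).add (hWint.const_mul t)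
  have hquad : ∫ ω, Real.exp (t * W ω) ∂P ≤ 1 + t * P[W] + 8 / a ^ 2 * t ^ 2 * K := by
    calc ∫ ω, Real.exp (t * W ω) ∂P
        ≤ ∫ ω, ((1 + t * W ω) + 8 / a ^ 2 * t ^ 2 * Real.exp (a * |W ω|)) ∂P :=
          integral_mono (hexp t ht)
            (hlin.add (hint.const_mul _)) fun ω =>
            (exp_le_one_add_add_sq_mul_exp_abs _).trans
              (by simpa using sq_mul_exp_abs_le (x := W ω) ha ht)
      _ = 1 + t * P[W] + 8 / a ^ 2 * t ^ 2 * ∫ ω, Real.exp (a * |W ω|) ∂P := by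
          rw [integral_add hlin (hint.const_mul _),
            integral_add (integrable_const 1) (hWint.const_mul t), integral_const_mul,
            integral_const_mul]
          simp
      _ ≤ 1 + t * P[W] + 8 / a ^ 2 * t ^ 2 * K := by gcongr
  calc mgf (fun ω => W ω - P[W]) P t
      = Real.exp (-(t * P[W])) * ∫ ω, Real.exp (t * W ω) ∂P := by
        simp only [mgf, hcenter, integral_const_mul]
    _ ≤ Real.exp (-(t * P[W])) * Real.exp (t * P[W] + 8 / a ^ 2 * t ^ 2 * K) := by
        gcongr
        linarith [Real.add_one_le_exp (t * P[W] + 8 / a ^ 2 * t ^ 2 * K)]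
    _ = Real.exp (16 * K / a ^ 2 * t ^ 2 / 2) := by
        rw [← Real.exp_add]
        ring_nf

end Subexponential

section SubgaussianProduct

variable {Ω : Type*} [MeasurableSpace Ω] {P : Measure Ω}

/-- The Gaussian identity `E exp (g u / √(2c)) = exp (u² / (4c))` linearizes the square. -/
theorem lintegral_exp_mul_gaussianReal {c : ℝ} (hc : 0 < c) (u : ℝ) :
    ∫⁻ g, ENNReal.ofReal (Real.exp (g / √(2 * c) * u)) ∂(gaussianReal 0 1)
      = ENNReal.ofReal (Real.exp (u ^ 2 / (4 * c))) := by
  have hmgf := congrFun (mgf_fun_id_gaussianReal (μ := 0) (v := 1)) (u / √(2 * c))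
  have hcomm : ∀ g : ℝ, g / √(2 * c) * u = u / √(2 * c) * g := fun g => by ring
  simp_rw [hcomm]
  rw [← ofReal_integral_eq_lintegral_ofReal (integrable_exp_mul_gaussianReal _)
    (Eventually.of_forall fun g => (Real.exp_pos _).le), ← mgf, hmgf, div_pow,
    Real.sq_sqrt (by positivity)]
  congr 2
  push_cast
  field

theorem lintegral_exp_sq_div_four_gaussianReal :
    ∫⁻ g, ENNReal.ofReal (Real.exp (g ^ 2 / 4)) ∂(gaussianReal 0 1) = ENNReal.ofReal √2 := by
  have hdens : ∀ g : ℝ, gaussianPDF 0 1 g * ENNReal.ofReal (Real.exp (g ^ 2 / 4))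
      = ENNReal.ofReal ((√(2 * Real.pi))⁻¹ * Real.exp (-(1 / 4) * g ^ 2)) := fun g => by
    rw [gaussianPDF, ← ENNReal.ofReal_mul (gaussianPDFReal_nonneg _ _ _), gaussianPDFReal]
    simp only [NNReal.coe_one, mul_one, sub_zero]
    rw [mul_assoc, ← Real.exp_add]
    congr 3
    ring
  rw [gaussianReal_of_var_ne_zero 0 one_ne_zero, lintegral_withDensity_eq_lintegral_mul₀
    (by fun_prop) (by fun_prop)]
  simp only [Pi.mul_apply, hdens]
  rw [← ofReal_integral_eq_lintegral_ofReal
    ((integrable_exp_neg_mul_sq (by norm_num)).const_mul _)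
    (Eventually.of_forall fun g => by positivity), integral_const_mul, integral_gaussian,
    ← Real.sqrt_inv, ← Real.sqrt_mul (by positivity)]
  congr 2
  field

theorem lintegral_exp_sq_le_of_hasSubgaussianMGF {U : Ω → ℝ} {c : NNReal} [SFinite P] (hc : 0 < c)
    (hU : HasSubgaussianMGF U c P) :
    ∫⁻ ω, ENNReal.ofReal (Real.exp (U ω ^ 2 / (4 * c))) ∂P ≤ ENNReal.ofReal √2 := by
  have hc' : (0 : ℝ) < c := hc
  have hfst : AEMeasurable (fun p : Ω × ℝ => U p.1) (P.prod (gaussianReal 0 1)) :=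
    hU.aemeasurable.comp_quasiMeasurePreserving Measure.quasiMeasurePreserving_fst
  have hjoint : AEMeasurable (Function.uncurry fun ω (g : ℝ) =>
      ENNReal.ofReal (Real.exp (g / √(2 * c) * U ω))) (P.prod (gaussianReal 0 1)) :=
    ((measurable_snd.div_const _).aemeasurable.mul hfst).exp.ennreal_ofReal
  simp_rw [← lintegral_exp_mul_gaussianReal hc']
  rw [lintegral_lintegral_swap hjoint,
    ← lintegral_exp_sq_div_four_gaussianReal]
  refine lintegral_mono fun g => ?_
  rw [← ofReal_integral_eq_lintegral_ofReal (hU.integrable_exp_mul _)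
    (Eventually.of_forall fun ω => (Real.exp_pos _).le)]
  refine ENNReal.ofReal_le_ofReal ((hU.mgf_le _).trans_eq ?_)
  rw [div_pow, Real.sq_sqrt (by positivity)]
  congr 1
  field

theorem integrable_exp_sq_of_hasSubgaussianMGF {U : Ω → ℝ} {c : NNReal} [SFinite P] (hc : 0 < c)
    (hU : HasSubgaussianMGF U c P) : Integrable (fun ω => Real.exp (U ω ^ 2 / (4 * c))) P := by
  have hUm := hU.aemeasurable
  refine ⟨by fun_prop, ?_⟩
  rw [hasFiniteIntegral_iff_ofReal (Eventually.of_forall fun ω => (Real.exp_pos _).le)]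
  exact (lintegral_exp_sq_le_of_hasSubgaussianMGF hc hU).trans_lt ENNReal.ofReal_lt_top

theorem integral_exp_sq_le_of_hasSubgaussianMGF {U : Ω → ℝ} {c : NNReal} [SFinite P] (hc : 0 < c)
    (hU : HasSubgaussianMGF U c P) : ∫ ω, Real.exp (U ω ^ 2 / (4 * c)) ∂P ≤ √2 := by
  rw [← ENNReal.ofReal_le_ofReal_iff (by positivity), ofReal_integral_eq_lintegral_ofReal
    (integrable_exp_sq_of_hasSubgaussianMGF hc hU)
    (Eventually.of_forall fun ω => (Real.exp_pos _).le)]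
  exact lintegral_exp_sq_le_of_hasSubgaussianMGF hc hU

theorem exp_mul_abs_mul_le {a : ℝ} (ha : 0 ≤ a) (u v : ℝ) :
    Real.exp (a * |u * v|) ≤ (Real.exp (a * u ^ 2) + Real.exp (a * v ^ 2)) / 2 := by
  have hamgm : a * |u * v| ≤ 1 / 2 * (a * u ^ 2) + 1 / 2 * (a * v ^ 2) := by
    rw [abs_mul]
    nlinarith [mul_nonneg ha (sq_nonneg (|u| - |v|)), sq_abs u, sq_abs v]
  calc Real.exp (a * |u * v|)
      ≤ Real.exp (1 / 2 * (a * u ^ 2) + 1 / 2 * (a * v ^ 2)) := Real.exp_le_exp.2 hamgm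
    _ ≤ 1 / 2 * Real.exp (a * u ^ 2) + 1 / 2 * Real.exp (a * v ^ 2) :=
        convexOn_exp.2 (Set.mem_univ _) (Set.mem_univ _) (by norm_num) (by norm_num) (by norm_num)
    _ = (Real.exp (a * u ^ 2) + Real.exp (a * v ^ 2)) / 2 := by ring

theorem hasSubexponentialMGF_mul_sub_integral [IsProbabilityMeasure P] {U V : Ω → ℝ} {c : NNReal}
    (hc : 0 < c) (hU : HasSubgaussianMGF U c P) (hV : HasSubgaussianMGF V c P) :
    HasSubexponentialMGF (fun ω => U ω * V ω - ∫ ω, U ω * V ω ∂P) (256 * √2 * c ^ 2) (1 / (8 * c))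
      P := by
  have : (0 : ℝ) < c := hc
  have hUm := hU.aemeasurable
  have hVm := hV.aemeasurable
  have hUi := integrable_exp_sq_of_hasSubgaussianMGF hc hU
  have hVi := integrable_exp_sq_of_hasSubgaussianMGF hc hV
  have hle : ∀ ω, Real.exp (1 / (4 * c) * |U ω * V ω|)
      ≤ (Real.exp (U ω ^ 2 / (4 * c)) + Real.exp (V ω ^ 2 / (4 * c))) / 2 := fun ω => by
    simpa only [one_div_mul_eq_div] using
      exp_mul_abs_mul_le (a := 1 / (4 * c)) (by positivity) (U ω) (V ω)
  have hdom := (hUi.add hVi).div_const 2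
  have hint : Integrable (fun ω => Real.exp (1 / (4 * c) * |U ω * V ω|)) P :=
    hdom.mono' (by fun_prop) (Eventually.of_forall fun ω => by
      rw [Real.norm_eq_abs, Real.abs_exp]
      exact hle ω)
  have hmoment : ∫ ω, Real.exp (1 / (4 * c) * |U ω * V ω|) ∂P ≤ √2 := by
    refine (integral_mono hint hdom hle).trans ?_
    simp only [Pi.add_apply]
    rw [integral_div, integral_add hUi hVi]
    linarith [integral_exp_sq_le_of_hasSubgaussianMGF hc hU,
      integral_exp_sq_le_of_hasSubgaussianMGF hc hV]
  have hcsq : (256 * √2 * c ^ 2 : ℝ) = 16 * √2 / (1 / (4 * c)) ^ 2 := by field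
  have hradius : (1 / (8 * c) : ℝ) = 1 / (4 * c) / 2 := by field
  rw [hcsq, hradius]
  exact hasSubexponentialMGF_sub_integral (by positivity) (hUm.mul hVm) hint hmoment

/-- The range of `u` is `u ≤ b c` for the sub-exponential parameters `(256√2 c², 1 / (8c))` of a
product. -/
theorem measureReal_abs_average_mul_sub_ge_le {N : ℕ} (hN : 0 < N) {U V : Fin N → Ω → ℝ}
    {c : NNReal} (hc : 0 < c) (hind : iIndepFun (fun i ω => U i ω * V i ω) P)
    (hU : ∀ i, HasSubgaussianMGF (U i) c P) (hV : ∀ i, HasSubgaussianMGF (V i) c P) {m u : ℝ}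
    (hm : ∀ i, ∫ ω, U i ω * V i ω ∂P = m) (hu : 0 ≤ u) (huc : u ≤ 32 * √2 * c) :
    P.real {ω | u ≤ |1 / (N : ℝ) * ∑ i, U i ω * V i ω - m|}
      ≤ 2 * Real.exp (-(N * u ^ 2 / (512 * √2 * c ^ 2))) := by
  have := hind.isProbabilityMeasure
  have : (0 : ℝ) < c := hc
  have hcenter : ∀ ω, 1 / (N : ℝ) * ∑ i, U i ω * V i ω - m
      = 1 / (N : ℝ) * ∑ i, (U i ω * V i ω - m) := fun ω => by
    rw [Finset.sum_sub_distrib, Finset.sum_const, Finset.card_univ, Fintype.card_fin, nsmul_eq_mul]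
    field
  simp only [hcenter]
  refine (HasSubexponentialMGF.measureReal_abs_average_ge_le hN (c := 256 * √2 * c ^ 2)
    (b := 1 / (8 * c)) (hind.comp (fun _ y => y - m) fun _ => by fun_prop)
    (fun i => ((hU i).aemeasurable.mul (hV i).aemeasurable).sub_const m)
    (fun i => by
      simpa only [hm i, Function.comp_def] using
        hasSubexponentialMGF_mul_sub_integral hc (hU i) (hV i))
    (by positivity) hu (huc.trans_eq (by field))).trans_eq ?_
  ring_nf

end SubgaussianProduct

section ConvergenceInDistribution

variable {Ω : ℕ → Type*} [∀ t, MeasurableSpace (Ω t)] {P : ∀ t, Measure (Ω t)}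
  [∀ t, IsProbabilityMeasure (P t)]

theorem tendstoInDistribution_of_eventually_hasLaw {ν : Measure ℝ} [IsProbabilityMeasure ν]
    {Z : ∀ t, Ω t → ℝ} (hZm : ∀ t, AEMeasurable (Z t) (P t))
    (hZ : ∀ᶠ t in atTop, HasLaw (Z t) ν (P t)) :
    TendstoInDistribution Z atTop (id : ℝ → ℝ) P ν := by
  refine ⟨hZm, aemeasurable_id, tendsto_nhds_of_eventually_eq ?_⟩
  filter_upwards [hZ] with t ht
  exact Subtype.ext (ht.map_eq.trans Measure.map_id.symm)

/-- Slutsky's theorem along varying probability spaces: it is the one on the product space. -/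
theorem tendstoInDistribution_of_measureReal_abs_sub_le {ν : Measure ℝ} [IsProbabilityMeasure ν]
    {T Z : ∀ t, Ω t → ℝ} (hT : ∀ t, AEMeasurable (T t) (P t))
    (hZ : TendstoInDistribution Z atTop (id : ℝ → ℝ) P ν)
    (hclose : ∀ η > 0, ∀ δ > 0, ∀ᶠ t in atTop, (P t).real {ω | η ≤ |T t ω - Z t ω|} ≤ δ) :
    TendstoInDistribution T atTop (id : ℝ → ℝ) P ν := by
  have heval := measurePreserving_eval_infinitePi P
  have hmap : ∀ {Y : ∀ t, Ω t → ℝ} (_ : ∀ t, AEMeasurable (Y t) (P t)) t,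
      (Measure.infinitePi P).map (fun ω => Y t (ω t)) = (P t).map (Y t) := fun {Y} hY t => by
    have hYt : AEMeasurable (Y t) ((Measure.infinitePi P).map (Function.eval t)) := by
      rw [(heval t).map_eq]
      exact hY t
    conv_rhs => rw [← (heval t).map_eq, AEMeasurable.map_map_of_aemeasurable hYt
      (heval t).measurable.aemeasurable]
    rfl
  have hcomp : ∀ {Y : ∀ t, Ω t → ℝ} (_ : ∀ t, AEMeasurable (Y t) (P t)) t,
      AEMeasurable (fun ω => Y t (ω t)) (Measure.infinitePi P) := fun hY t =>
    (hY t).comp_quasiMeasurePreserving (heval t).quasiMeasurePreserving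
  have hZ' : TendstoInDistribution (fun t ω => Z t (ω t)) atTop (id : ℝ → ℝ)
      (fun _ => Measure.infinitePi P) ν := by
    refine ⟨hcomp hZ.forall_aemeasurable, aemeasurable_id, ?_⟩
    simpa only [hmap hZ.forall_aemeasurable] using hZ.tendsto
  have hprob : TendstoInMeasure (Measure.infinitePi P)
      ((fun t ω => T t (ω t)) - fun t ω => Z t (ω t)) atTop 0 := by
    rw [tendstoInMeasure_iff_measureReal_norm]
    intro η hη
    refine tendsto_order.2
      ⟨fun a ha => Eventually.of_forall fun t => ha.trans_le measureReal_nonneg, fun δ hδ => ?_⟩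
    filter_upwards [hclose η hη (δ / 2) (by positivity)] with t ht
    refine lt_of_le_of_lt (le_of_eq ?_) (ht.trans_lt (half_lt_self hδ))
    have hS : NullMeasurableSet {ω | η ≤ |T t ω - Z t ω|} (P t) :=
      nullMeasurableSet_le aemeasurable_const ((hT t).sub (hZ.forall_aemeasurable t)).abs
    simpa using (heval t).measureReal_preimage hS
  have hT' := tendstoInDistribution_of_tendstoInMeasure_sub _ _ hZ' hprob (hcomp hT)
  refine ⟨hT, aemeasurable_id, ?_⟩
  simpa only [hmap hT] using hT'.tendsto

end ConvergenceInDistribution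

section GaussianSum

variable {Ω : Type*} [MeasurableSpace Ω] {P : Measure Ω}

theorem hasLaw_comp_prodMk_of_indepFun {α β γ : Type*} [MeasurableSpace α]
    [MeasurableSpace β] [MeasurableSpace γ] [IsProbabilityMeasure P] {X : Ω → α} {Y : Ω → β}
    {f : α → β → γ} {ν : Measure γ} (hX : AEMeasurable X P) (hY : AEMeasurable Y P)
    (hind : IndepFun X Y P) (hf : Measurable (Function.uncurry f))
    (hlaw : ∀ x, HasLaw (fun ω => f x (Y ω)) ν P) : HasLaw (fun ω => f (X ω) (Y ω)) ν P := by
  have hXY : AEMeasurable (fun ω => (X ω, Y ω)) P := hX.prodMk hY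
  have := Measure.isProbabilityMeasure_map (μ := P) hX
  have := Measure.isProbabilityMeasure_map (μ := P) hY
  refine ⟨hf.comp_aemeasurable hXY, ?_⟩
  have hsection : ∀ x, (P.map Y).map (f x) = ν := fun x => by
    rw [AEMeasurable.map_map_of_aemeasurable (by fun_prop) hY]
    exact (hlaw x).map_eq
  have hjoint : P.map (fun ω => f (X ω) (Y ω))
      = ((P.map X).prod (P.map Y)).map (Function.uncurry f) := by
    rw [← (indepFun_iff_map_prod_eq_prod_map_map hX hY).1 hind,
      AEMeasurable.map_map_of_aemeasurable hf.aemeasurable hXY]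
    rfl
  rw [hjoint]
  ext B hB
  rw [Measure.map_apply hf hB, Measure.prod_apply (hf hB)]
  calc ∫⁻ x, (P.map Y) (Prod.mk x ⁻¹' (Function.uncurry f ⁻¹' B)) ∂P.map X
      = ∫⁻ _, ν B ∂P.map X := by
        refine lintegral_congr fun x => ?_
        rw [← hsection x, Measure.map_apply (by fun_prop) hB]
        rfl
    _ = ν B := by simp

theorem hasLaw_sum_gaussianReal {ι : Type*} {X : ι → Ω → ℝ} {v : ι → NNReal}
    (hind : iIndepFun X P) (hX : ∀ i, HasLaw (X i) (gaussianReal 0 (v i)) P) (s : Finset ι) :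
    HasLaw (∑ i ∈ s, X i) (gaussianReal 0 (∑ i ∈ s, v i)) P := by
  have := hind.isProbabilityMeasure
  classical
  induction s using Finset.induction_on with
  | empty =>
    simp only [Finset.sum_empty, gaussianReal_zero_var]
    exact hasLaw_dirac_of_ae_eq (Eventually.of_forall fun _ => rfl)
  | insert i s hi ih =>
    rw [Finset.sum_insert hi, Finset.sum_insert hi]
    refine ⟨(hX i).aemeasurable.add ih.aemeasurable, ?_⟩
    simpa using gaussianReal_add_gaussianReal_of_indepFun
      (hind.indepFun_finsetSum_of_notMem₀ (fun i => (hX i).aemeasurable) hi).symm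
      (hX i).map_eq ih.map_eq

namespace IsGaussianNoise

variable {N : ℕ} {σ : ℝ} {ε : Ω → Fin N → ℝ}

theorem aemeasurable_apply (h : IsGaussianNoise σ ε P) (i : Fin N) :
    AEMeasurable (fun ω => ε ω i) P :=
  (h.law i).aemeasurable

theorem aemeasurable (h : IsGaussianNoise σ ε P) : AEMeasurable ε P :=
  aemeasurable_pi_iff.2 h.aemeasurable_apply

theorem hasLaw_sum (h : IsGaussianNoise σ ε P) (hσ : 0 < σ) {w : Fin N → ℝ}
    (hw : ∑ i, w i ^ 2 = 1) : HasLaw (fun ω => ∑ i, w i * (ε ω i / σ)) (gaussianReal 0 1) P := by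
  have hlaw : ∀ i, HasLaw (fun ω => w i * (ε ω i / σ))
      (gaussianReal 0 (Real.toNNReal (w i ^ 2))) P := fun i => by
    convert gaussianReal_const_mul (gaussianReal_div_const (h.law i) σ) (w i) using 2
    · simp
    · ext
      simp [Real.coe_toNNReal _ (sq_nonneg _)]
      field
  convert hasLaw_sum_gaussianReal (h.indep.comp (fun i y => w i * (y / σ)) fun i => by fun_prop)
    hlaw Finset.univ using 1
  · ext ω
    simp
  · rw [← Real.toNNReal_sum_of_nonneg fun i _ => sq_nonneg _, hw, Real.toNNReal_one]

theorem hasLaw_sum_of_indepFun [IsProbabilityMeasure P] {α : Type*} [MeasurableSpace α]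
    (h : IsGaussianNoise σ ε P) (hσ : 0 < σ) {X : Ω → α} (hX : AEMeasurable X P)
    (hind : IndepFun X ε P) {w : α → Fin N → ℝ} (hwm : Measurable w)
    (hw : ∀ x, ∑ i, w x i ^ 2 = 1) :
    HasLaw (fun ω => ∑ i, w (X ω) i * (ε ω i / σ)) (gaussianReal 0 1) P :=
  hasLaw_comp_prodMk_of_indepFun (f := fun x e => ∑ i, w x i * (e i / σ)) hX h.aemeasurable hind
    (by unfold Function.uncurry; fun_prop) fun x => h.hasLaw_sum hσ (hw x)

end IsGaussianNoise

end GaussianSum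

section Norms

variable {ι : Type} [Fintype ι]

/-- The Euclidean norm of a vector, next to `l1` and `l0`. It is spelled out because `ι → ℝ`
carries the sup norm. -/
noncomputable def l2 (v : ι → ℝ) : ℝ := √(∑ i, v i ^ 2)

theorem l2_nonneg (v : ι → ℝ) : 0 ≤ l2 v := Real.sqrt_nonneg _

theorem l2_sq (v : ι → ℝ) : l2 v ^ 2 = ∑ i, v i ^ 2 :=
  Real.sq_sqrt (Finset.sum_nonneg fun _ _ => sq_nonneg _)

theorem norm_toLp_eq_l2 (v : ι → ℝ) : ‖WithLp.toLp 2 v‖ = l2 v := by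
  simp [EuclideanSpace.norm_eq, l2]

theorem l2_eq_zero_iff (v : ι → ℝ) : l2 v = 0 ↔ v = 0 := by
  rw [← norm_toLp_eq_l2, norm_eq_zero, WithLp.toLp_eq_zero]

theorem l1_nonneg (v : ι → ℝ) : 0 ≤ l1 v := Finset.sum_nonneg fun _ _ => abs_nonneg _

theorem sum_abs_le_sqrt_card_mul_l2 (s : Finset ι) (v : ι → ℝ) :
    ∑ i ∈ s, |v i| ≤ √s.card * l2 v := by
  rw [l2, ← Real.sqrt_mul (by positivity)]
  refine Real.le_sqrt_of_sq_le (sq_sum_le_card_mul_sum_sq.trans ?_)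
  simp only [sq_abs]
  gcongr
  exact Finset.subset_univ s

theorem l1_le_sqrt_card_mul_l2 (v : ι → ℝ) : l1 v ≤ √(Fintype.card ι) * l2 v :=
  sum_abs_le_sqrt_card_mul_l2 Finset.univ v

theorem l1_sub_l1_add_le_l1 (u g : ι → ℝ) : l1 u - l1 (u + g) ≤ l1 g := by
  rw [l1, l1, l1, ← Finset.sum_sub_distrib]
  refine Finset.sum_le_sum fun i _ => ?_
  simpa using abs_sub_abs_le_abs_sub (u i) (u i + g i)

/-- On the support of `u` the perturbation `g` removes at most its own mass, off the support it only
adds mass. -/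
theorem l1_sub_l1_add_le (u g : ι → ℝ) : l1 u - l1 (u + g) ≤ 2 * (√(l0 u) * l2 g) - l1 g := by
  classical
  have hcard : l0 u = (Finset.univ.filter fun i => u i ≠ 0).card := by
    rw [l0, ← Set.ncard_coe_finset, Finset.coe_filter_univ]
    rfl
  have hsupport : l1 u - l1 (u + g)
      ≤ 2 * ∑ i ∈ Finset.univ.filter fun i => u i ≠ 0, |g i| - l1 g := by
    rw [Finset.sum_filter, Finset.mul_sum, l1, l1, l1, ← Finset.sum_sub_distrib,
      ← Finset.sum_sub_distrib]
    refine Finset.sum_le_sum fun i _ => ?_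
    by_cases hi : u i = 0
    · simp [hi]
    · have := abs_sub_abs_le_abs_sub (u i) (u i + g i)
      simp only [sub_add_cancel_left, abs_neg] at this
      simp only [Pi.add_apply, ne_eq, hi, not_false_eq_true, if_true]
      linarith
  rw [hcard]
  linarith [sum_abs_le_sqrt_card_mul_l2 (Finset.univ.filter fun i => u i ≠ 0) g]

theorem l1_sub_l1_add_le_sqrt_l0_mul_l2 (u g : ι → ℝ) :
    l1 u - l1 (u + g) ≤ √(l0 u) * l2 g := by
  linarith [l1_sub_l1_add_le u g, l1_sub_l1_add_le_l1 u g]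

end Norms

section GraphDifference

open scoped Matrix.Norms.L2Operator

theorem l2_mulVec_le {ι κ : Type} [Fintype ι] [Fintype κ] [DecidableEq κ] (A : Matrix ι κ ℝ)
    (v : κ → ℝ) : l2 (A *ᵥ v) ≤ ‖A‖ * l2 v := by
  rw [← norm_toLp_eq_l2, ← norm_toLp_eq_l2]
  exact l2_opNorm_mulVec A (WithLp.toLp 2 v)

theorem l2_opNorm_le_of_l2_mulVec_le {ι κ : Type} [Fintype ι] [Fintype κ] [DecidableEq κ]
    {A : Matrix ι κ ℝ} {M : ℝ} (hM : 0 ≤ M) (hA : ∀ v, l2 (A *ᵥ v) ≤ M * l2 v) : ‖A‖ ≤ M := by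
  refine ContinuousLinearMap.opNorm_le_bound _ hM fun x => ?_
  have := hA (WithLp.ofLp x)
  rw [← norm_toLp_eq_l2, ← norm_toLp_eq_l2] at this
  exact this

variable {n : ℕ} (G : SimpleGraph (Fin n))

theorem maxDeg_nonneg : 0 ≤ maxDeg G := Nat.cast_nonneg _

theorem incidence_mulVec_apply (v : Fin n → ℝ) (e : Edge G) :
    (incidence G *ᵥ v) e = v e.1.2 - v e.1.1 := by
  have hne : e.1.2 ≠ e.1.1 := e.2.1.ne'
  have hrow : incidence G e = Pi.single e.1.2 1 - Pi.single e.1.1 1 := by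
    ext x
    simp only [incidence, Pi.sub_apply, Pi.single_apply]
    split_ifs with h1 h2 <;> simp_all
  rw [mulVec, hrow, sub_dotProduct, single_one_dotProduct, single_one_dotProduct]

theorem two_mul_sum_edge [DecidableRel G.Adj] {f : Fin n → Fin n → ℝ}
    (hf : ∀ i j, f i j = f j i) :
    2 * ∑ e : Edge G, f e.1.1 e.1.2 = ∑ i, ∑ j, if G.Adj i j then f i j else 0 := by
  have hedge : ∑ e : Edge G, f e.1.1 e.1.2
      = ∑ i, ∑ j, if i < j ∧ G.Adj i j then f i j else 0 := by
    rw [← Fintype.sum_prod_type' (f := fun i j => if i < j ∧ G.Adj i j then f i j else 0),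
      ← Finset.sum_filter]
    exact (Finset.sum_subtype _ (p := fun p : Fin n × Fin n => p.1 < p.2 ∧ G.Adj p.1 p.2)
      (by simp) fun p => f p.1 p.2).symm
  have hswap : ∑ i, ∑ j, (if i < j ∧ G.Adj i j then f i j else 0)
      = ∑ i, ∑ j, if j < i ∧ G.Adj i j then f i j else 0 := by
    rw [Finset.sum_comm]
    simp only [G.adj_comm, hf]
  have hsplit : ∀ i j, (if i < j ∧ G.Adj i j then f i j else 0)
      + (if j < i ∧ G.Adj i j then f i j else 0) = if G.Adj i j then f i j else 0 := fun i j => by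
    rcases lt_trichotomy i j with h | rfl | h <;> simp [*, not_lt_of_gt]
  simp only [← hsplit, Finset.sum_add_distrib, ← hswap, hedge, two_mul]

theorem sum_sum_adj_le (w : Fin n → ℝ) (hw : ∀ i, 0 ≤ w i) [DecidableRel G.Adj] :
    ∑ i, ∑ j, (if G.Adj i j then w i else 0) ≤ maxDeg G * ∑ i, w i := by
  have hdeg : ∀ i, (G.degree i : ℝ) ≤ maxDeg G := fun i => by
    refine Nat.cast_le.2 ?_
    convert G.degree_le_maxDegree i
  rw [Finset.mul_sum]
  refine Finset.sum_le_sum fun i _ => ?_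
  rw [← Finset.sum_filter, Finset.sum_const, ← SimpleGraph.neighborFinset_eq_filter,
    SimpleGraph.card_neighborFinset_eq_degree, nsmul_eq_mul]
  exact mul_le_mul_of_nonneg_right (hdeg i) (hw i)

theorem l2_opNorm_incidence_le : ‖incidence G‖ ≤ √(2 * maxDeg G) := by
  classical
  refine l2_opNorm_le_of_l2_mulVec_le (Real.sqrt_nonneg _) fun v => ?_
  have hd := maxDeg_nonneg G
  rw [l2, l2, ← Real.sqrt_mul (by positivity)]
  refine Real.sqrt_le_sqrt ?_
  have hpoint : ∀ e, (incidence G *ᵥ v) e ^ 2 ≤ 2 * (v e.1.1 ^ 2 + v e.1.2 ^ 2) := fun e => by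
    rw [incidence_mulVec_apply]
    nlinarith [sq_nonneg (v e.1.2 + v e.1.1)]
  have hsymm : ∑ i, ∑ j, (if G.Adj i j then v j ^ 2 else 0)
      = ∑ i, ∑ j, if G.Adj i j then v i ^ 2 else 0 := by
    rw [Finset.sum_comm]
    simp only [G.adj_comm]
  calc ∑ e, (incidence G *ᵥ v) e ^ 2
      ≤ 2 * ∑ e : Edge G, (v e.1.1 ^ 2 + v e.1.2 ^ 2) := by
        rw [Finset.mul_sum]
        exact Finset.sum_le_sum fun e _ => hpoint e
    _ = ∑ i, ∑ j, if G.Adj i j then v i ^ 2 + v j ^ 2 else 0 :=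
        two_mul_sum_edge G (f := fun i j => v i ^ 2 + v j ^ 2) fun i j => add_comm _ _
    _ = 2 * ∑ i, ∑ j, if G.Adj i j then v i ^ 2 else 0 := by
        simp only [ite_add_zero, Finset.sum_add_distrib, hsymm, two_mul]
    _ ≤ 2 * maxDeg G * ∑ i, v i ^ 2 := by
        linarith [sum_sum_adj_le G (fun i => v i ^ 2) fun i => sq_nonneg _]

theorem l2_opNorm_laplacian_le : ‖laplacian G‖ ≤ √(2 * maxDeg G) ^ 2 := by
  rw [laplacian, ← conjTranspose_eq_transpose_of_trivial, l2_opNorm_conjTranspose_mul_self, ← sq]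
  gcongr
  exact l2_opNorm_incidence_le G

theorem l2_opNorm_laplacian_pow_le (m : ℕ) :
    ‖laplacian G ^ m‖ ≤ √(2 * maxDeg G) ^ (2 * m) := by
  rcases m.eq_zero_or_pos with rfl | hm
  · rw [pow_zero, mul_zero, pow_zero]
    exact l2_opNorm_le_of_l2_mulVec_le zero_le_one fun v => by simp
  · rw [pow_mul]
    exact (norm_pow_le' _ hm).trans (pow_le_pow_left₀ (norm_nonneg _) (l2_opNorm_laplacian_le G) m)

theorem l2_opNorm_graphDiff_le (k : ℕ) : ‖graphDiff G k‖ ≤ √(2 * maxDeg G) ^ (k + 1) := by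
  rcases Nat.even_or_odd k with hk | hk
  · have hodd : decide (Odd k) = false := by simpa using hk
    rw [graphDiff, hodd]
    calc ‖incidence G * laplacian G ^ (k / 2)‖
        ≤ ‖incidence G‖ * ‖laplacian G ^ (k / 2)‖ := l2_opNorm_mul _ _
      _ ≤ √(2 * maxDeg G) * √(2 * maxDeg G) ^ (2 * (k / 2)) := by
          gcongr
          exacts [l2_opNorm_incidence_le G, l2_opNorm_laplacian_pow_le G _]
      _ = √(2 * maxDeg G) ^ (k + 1) := by rw [Nat.two_mul_div_two_of_even hk, pow_succ']
  · have hodd : decide (Odd k) = true := by simpa using hk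
    rw [graphDiff, hodd]
    have := l2_opNorm_laplacian_pow_le G ((k + 1) / 2)
    rwa [Nat.two_mul_div_two_of_even hk.add_one] at this

theorem l2_graphDiff_mulVec_le (k : ℕ) (v : Fin n → ℝ) :
    l2 (graphDiff G k *ᵥ v) ≤ √(2 * maxDeg G) ^ (k + 1) * l2 v :=
  (l2_mulVec_le _ v).trans
    (mul_le_mul_of_nonneg_right (l2_opNorm_graphDiff_le G k) (l2_nonneg v))

end GraphDifference

section Lasso

theorem abs_dotProduct_mulVec_le {ι : Type} [Fintype ι] {M : Matrix ι ι ℝ} {D : ℝ}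
    (hM : ∀ a b, |M a b| ≤ D) (h : ι → ℝ) : |h ⬝ᵥ (M *ᵥ h)| ≤ D * l1 h ^ 2 := by
  have hrow : ∀ a, |(M *ᵥ h) a| ≤ D * l1 h := fun a => by
    rw [l1, Finset.mul_sum]
    refine (Finset.abs_sum_le_sum_abs _ _).trans (Finset.sum_le_sum fun b _ => ?_)
    rw [abs_mul]
    exact mul_le_mul_of_nonneg_right (hM a b) (abs_nonneg _)
  calc |h ⬝ᵥ (M *ᵥ h)| ≤ ∑ a, |h a * (M *ᵥ h) a| := Finset.abs_sum_le_sum_abs _ _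
    _ ≤ ∑ a, |h a| * (D * l1 h) := Finset.sum_le_sum fun a _ => by
        rw [abs_mul]
        exact mul_le_mul_of_nonneg_left (hrow a) (abs_nonneg _)
    _ = D * l1 h ^ 2 := by
        rw [← Finset.sum_mul, ← l1]
        ring

variable {N n : ℕ} {X : Matrix (Fin N) (Fin n) ℝ}

/-- The constraint `ν ≤ s₂ / s₁` is what balances the two penalties: the graph part costs no more
than the sparsity part. -/
theorem graph_penalty_le {G : SimpleGraph (Fin n)} {k : ℕ} {ν s₁ s₂ lam : ℝ} (hν : 0 ≤ ν)
    (hs₁ : 0 ≤ s₁) (hνs : ν * s₁ ≤ s₂) (hlam : 0 ≤ lam) {β : Fin n → ℝ}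
    (hβ : (l0 (graphDiff G k *ᵥ β) : ℝ) ≤ s₁) (h : Fin n → ℝ) :
    lam * √(ν / (2 * maxDeg G) ^ (k + 1))
        * (l1 (graphDiff G k *ᵥ β) - l1 (graphDiff G k *ᵥ (β + h)))
      ≤ lam * (√s₂ * l2 h) := by
  have hd := maxDeg_nonneg G
  set D := (2 * maxDeg G) ^ (k + 1)
  have hdrop : l1 (graphDiff G k *ᵥ β) - l1 (graphDiff G k *ᵥ (β + h)) ≤ √s₁ * (√D * l2 h) := by
    have hsqrt : √D = √(2 * maxDeg G) ^ (k + 1) := Real.sqrt_eq_iff_mul_self_eq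
      (by positivity) (by positivity) |>.2 <| by
        rw [← mul_pow, Real.mul_self_sqrt (by positivity)]
    rw [mulVec_add, hsqrt]
    refine (l1_sub_l1_add_le_sqrt_l0_mul_l2 _ _).trans ?_
    gcongr
    exacts [l2_nonneg _, l2_graphDiff_mulVec_le G k h]
  have hbalance : √(ν / D) * (√s₁ * √D) ≤ √s₂ := by
    rw [← Real.sqrt_mul hs₁, ← Real.sqrt_mul (by positivity)]
    refine Real.sqrt_le_sqrt ?_
    calc ν / D * (s₁ * D) = ν * s₁ * (D / D) := by ring
      _ ≤ ν * s₁ * 1 := mul_le_mul_of_nonneg_left (div_self_le_one D) (mul_nonneg hν hs₁)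
      _ ≤ s₂ := by rwa [mul_one]
  calc lam * √(ν / D) * (l1 (graphDiff G k *ᵥ β) - l1 (graphDiff G k *ᵥ (β + h)))
      ≤ lam * √(ν / D) * (√s₁ * (√D * l2 h)) := by gcongr
    _ = lam * (√(ν / D) * (√s₁ * √D) * l2 h) := by ring
    _ ≤ lam * (√s₂ * l2 h) := by
        gcongr
        exact l2_nonneg h

theorem dotProduct_sampleCov_mulVec (X : Matrix (Fin N) (Fin n) ℝ) (h : Fin n → ℝ) :
    h ⬝ᵥ (sampleCov X *ᵥ h) = 1 / N * ∑ i, (X *ᵥ h) i ^ 2 := by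
  rw [sampleCov, smul_mulVec, dotProduct_smul, ← mulVec_mulVec, dotProduct_mulVec,
    vecMul_transpose, smul_eq_mul, dotProduct]
  simp only [sq]

theorem le_dotProduct_sampleCov_mulVec {S : Matrix (Fin n) (Fin n) ℝ} {c D : ℝ}
    (hS : ∀ v, c * l2 v ^ 2 ≤ v ⬝ᵥ (S *ᵥ v)) (hD : ∀ a b, |sampleCov X a b - S a b| ≤ D)
    (h : Fin n → ℝ) : c * l2 h ^ 2 - D * l1 h ^ 2 ≤ h ⬝ᵥ (sampleCov X *ᵥ h) := by
  have hdiff := (abs_le.1 (abs_dotProduct_mulVec_le (M := sampleCov X - S) hD h)).1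
  rw [sub_mulVec, dotProduct_sub] at hdiff
  linarith [hS h]

theorem average_mul_mulVec_le {ε : Fin N → ℝ} {τ : ℝ}
    (hτ : ∀ a, |1 / (N : ℝ) * ∑ i, X i a * ε i| ≤ τ) (h : Fin n → ℝ) :
    1 / (N : ℝ) * ∑ i, ε i * (X *ᵥ h) i ≤ τ * l1 h := by
  have hcomm : 1 / (N : ℝ) * ∑ i, ε i * (X *ᵥ h) i
      = ∑ a, (1 / (N : ℝ) * ∑ i, X i a * ε i) * h a := by
    simp only [mulVec, dotProduct, Finset.mul_sum, Finset.sum_mul]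
    rw [Finset.sum_comm]
    exact Finset.sum_congr rfl fun a _ => Finset.sum_congr rfl fun i _ => by ring
  rw [hcomm, l1, Finset.mul_sum]
  refine Finset.sum_le_sum fun a _ => (le_abs_self _).trans ?_
  rw [abs_mul]
  exact mul_le_mul_of_nonneg_right (hτ a) (abs_nonneg _)

theorem response_sub_mulVec (X : Matrix (Fin N) (Fin n) ℝ) (β b : Fin n → ℝ) (ε : Fin N → ℝ) :
    response X β ε - X *ᵥ b = ε - X *ᵥ (b - β) := by
  rw [response, mulVec_sub]
  abel

variable {G : SimpleGraph (Fin n)} {k : ℕ} {lamg lam ν s₁ s₂ s c D τ : ℝ} {β b : Fin n → ℝ}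
  {ε : Fin N → ℝ} {S : Matrix (Fin n) (Fin n) ℝ}

theorem lasso_basic_inequality
    (hb : objective G k lamg lam X (response X β ε) b
      ≤ objective G k lamg lam X (response X β ε) β) :
    1 / (N : ℝ) * (∑ i, (X *ᵥ (b - β)) i ^ 2) / 2
      ≤ 1 / (N : ℝ) * ∑ i, ε i * (X *ᵥ (b - β)) i
        + lamg * (l1 (graphDiff G k *ᵥ β) - l1 (graphDiff G k *ᵥ b)) + lam * (l1 β - l1 b) := by
  have hres : ∀ i, response X β ε i - (X *ᵥ b) i = ε i - (X *ᵥ (b - β)) i := fun i =>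
    congrFun (response_sub_mulVec X β b ε) i
  have hres' : ∀ i, response X β ε i - (X *ᵥ β) i = ε i := fun i => by
    rw [response, Pi.add_apply, add_sub_cancel_left]
  have hcross : ∑ i, 2 * ε i * (X *ᵥ (b - β)) i = 2 * ∑ i, ε i * (X *ᵥ (b - β)) i := by
    simp only [mul_assoc, Finset.mul_sum]
  have hhalf : 1 / (2 * (N : ℝ)) = 1 / N / 2 := by rw [div_div, mul_comm]
  simp only [objective, hres, hres', sub_sq, Finset.sum_add_distrib, Finset.sum_sub_distrib,
    hcross, hhalf] at hb
  linarith

theorem lasso_penalized_inequality (hν : 0 ≤ ν) (hs₁ : 0 ≤ s₁) (hνs : ν * s₁ ≤ s₂) (hs : s₂ ≤ s)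
    (hlam : 0 ≤ lam) (hlamg : lamg = lam * √(ν / (2 * maxDeg G) ^ (k + 1)))
    (hβ : β ∈ paramSpace G k s₁ s₂)
    (hb : objective G k lamg lam X (response X β ε) b
      ≤ objective G k lamg lam X (response X β ε) β)
    (hτ : ∀ a, |1 / (N : ℝ) * ∑ i, X i a * ε i| ≤ τ) :
    1 / (N : ℝ) * (∑ i, (X *ᵥ (b - β)) i ^ 2) / 2
      ≤ τ * l1 (b - β) + lam * (3 * (√s * l2 (b - β)) - l1 (b - β)) := by
  have hbasic := lasso_basic_inequality hb
  have hnoise := average_mul_mulVec_le hτ (b - β)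
  have hgraph := graph_penalty_le hν hs₁ hνs hlam hβ.1 (b - β)
  have hsparse := l1_sub_l1_add_le β (b - β)
  rw [add_sub_cancel] at hgraph hsparse
  rw [← hlamg] at hgraph
  have hq := l2_nonneg (b - β)
  have hgraph_s : lam * (√s₂ * l2 (b - β)) ≤ lam * (√s * l2 (b - β)) := by gcongr
  have hsparse_s : lam * (l1 β - l1 b) ≤ lam * (2 * (√s * l2 (b - β)) - l1 (b - β)) := by
    refine mul_le_mul_of_nonneg_left (hsparse.trans ?_) hlam
    gcongr
    exact hβ.2.trans hs
  linarith

/-- The two ways into the cone: the penalty dominates the noise, or `s` dominates the dimension. -/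
theorem l1_le_of_lasso_penalized_inequality {h : Fin n → ℝ} {Q : ℝ} (hQ : 0 ≤ Q) (hlam : 0 < lam)
    (hmain : Q / 2 ≤ τ * l1 h + lam * (3 * (√s * l2 h) - l1 h)) (hcase : 2 * τ ≤ lam ∨ n ≤ s) :
    l1 h ≤ 6 * (√s * l2 h) := by
  have hl1 := l1_nonneg h
  have hq := l2_nonneg h
  rcases hcase with hnoise | hdim
  · have hτ : 2 * τ * l1 h ≤ lam * l1 h := by gcongr
    have : 0 ≤ lam * (6 * (√s * l2 h) - l1 h) := by linarith
    linarith [nonneg_of_mul_nonneg_right this hlam]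
  · have hcard := l1_le_sqrt_card_mul_l2 h
    rw [Fintype.card_fin] at hcard
    have : √(n : ℝ) * l2 h ≤ √s * l2 h := by gcongr
    have : 0 ≤ √s * l2 h := by positivity
    linarith

theorem l2_sq_le_dotProduct_sampleCov_mulVec_of_l1_le
    (hS : ∀ v, c * l2 v ^ 2 ≤ v ⬝ᵥ (S *ᵥ v)) (hD0 : 0 ≤ D)
    (hD : ∀ a b, |sampleCov X a b - S a b| ≤ D) (hs : 0 ≤ s) (hDs : 36 * D * s ≤ c / 2)
    {h : Fin n → ℝ} (hcone : l1 h ≤ 6 * (√s * l2 h)) :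
    c / 2 * l2 h ^ 2 ≤ h ⬝ᵥ (sampleCov X *ᵥ h) := by
  have hquad := le_dotProduct_sampleCov_mulVec hS hD h
  have hl1 : D * l1 h ^ 2 ≤ c / 2 * l2 h ^ 2 := by
    have := l1_nonneg h
    calc D * l1 h ^ 2 ≤ D * (6 * (√s * l2 h)) ^ 2 := by gcongr
      _ = 36 * D * √s ^ 2 * l2 h ^ 2 := by ring
      _ ≤ c / 2 * l2 h ^ 2 := by
          rw [Real.sq_sqrt hs]
          gcongr
  linarith

theorem lasso_error_bound (hν : 0 ≤ ν) (hs₁ : 0 ≤ s₁) (hνs : ν * s₁ ≤ s₂) (hs : s₂ ≤ s)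
    (hlam : 0 < lam) (hlamg : lamg = lam * √(ν / (2 * maxDeg G) ^ (k + 1)))
    (hβ : β ∈ paramSpace G k s₁ s₂)
    (hb : objective G k lamg lam X (response X β ε) b
      ≤ objective G k lamg lam X (response X β ε) β)
    (hc : 0 < c) (hS : ∀ v, c * l2 v ^ 2 ≤ v ⬝ᵥ (S *ᵥ v)) (hD0 : 0 ≤ D)
    (hD : ∀ a b, |sampleCov X a b - S a b| ≤ D) (hDs : 36 * D * s ≤ c / 2) (hτ0 : 0 ≤ τ)
    (hτ : ∀ a, |1 / (N : ℝ) * ∑ i, X i a * ε i| ≤ τ) (hcase : 2 * τ ≤ lam ∨ n ≤ s) :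
    l1 (b - β) ≤ 24 / c * (6 * τ + 3 * lam) * s ∧
      1 / (N : ℝ) * ∑ i, (X *ᵥ (b - β)) i ^ 2 ≤ 8 / c * (6 * τ + 3 * lam) ^ 2 * s := by
  have hs0 : 0 ≤ s := (mul_nonneg hν hs₁).trans (hνs.trans hs)
  have hmain := lasso_penalized_inequality hν hs₁ hνs hs hlam.le hlamg hβ hb hτ
  set h := b - β
  set Q := 1 / (N : ℝ) * ∑ i, (X *ᵥ h) i ^ 2 with hQ
  have hQ0 : 0 ≤ Q := by positivity
  have hcone := l1_le_of_lasso_penalized_inequality hQ0 hlam hmain hcase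
  have hlower := l2_sq_le_dotProduct_sampleCov_mulVec_of_l1_le hS hD0 hD hs0 hDs hcone
  rw [dotProduct_sampleCov_mulVec, ← hQ] at hlower
  set q := l2 h
  have hq : 0 ≤ q := l2_nonneg h
  set A := 6 * τ + 3 * lam with hA
  have hupper : Q ≤ 2 * (A * (√s * q)) := by
    have hnoise : τ * l1 h ≤ τ * (6 * (√s * q)) := by gcongr
    have : 0 ≤ lam * l1 h := mul_nonneg hlam.le (l1_nonneg h)
    rw [hA]
    linarith
  have hqle : q ≤ 4 / c * A * √s := by
    rcases hq.eq_or_lt with h0 | h0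
    · rw [← h0]
      positivity
    · have : q * (c * q) ≤ q * (4 * A * √s) := by linarith
      rw [div_mul_eq_mul_div, div_mul_eq_mul_div, le_div_iff₀' hc]
      exact le_of_mul_le_mul_left this h0
  constructor
  · calc l1 h ≤ 6 * (√s * q) := hcone
      _ ≤ 6 * (√s * (4 / c * A * √s)) := by gcongr
      _ = 24 / c * A * √s ^ 2 := by ring
      _ = 24 / c * A * s := by rw [Real.sq_sqrt hs0]
  · calc Q ≤ 2 * (A * (√s * q)) := hupper
      _ ≤ 2 * (A * (√s * (4 / c * A * √s))) := by gcongr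
      _ = 8 / c * A ^ 2 * √s ^ 2 := by ring
      _ = 8 / c * A ^ 2 * s := by rw [Real.sq_sqrt hs0]

end Lasso

section OneStep

variable {N n : ℕ} {X : Matrix (Fin N) (Fin n) ℝ} {Θ : Matrix (Fin n) (Fin n) ℝ}

theorem sampleCov_apply (X : Matrix (Fin N) (Fin n) ℝ) (a b : Fin n) :
    sampleCov X a b = 1 / (N : ℝ) * ∑ i, X i a * X i b := by
  rw [sampleCov, Matrix.smul_apply, smul_eq_mul, mul_apply]
  rfl

theorem mul_sampleCov_apply (X : Matrix (Fin N) (Fin n) ℝ) (Θ : Matrix (Fin n) (Fin n) ℝ)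
    (a b : Fin n) : (Θ * sampleCov X) a b = 1 / (N : ℝ) * ∑ i, (X * Θᵀ) i a * X i b := by
  have h : Θ * sampleCov X = (1 / (N : ℝ)) • ((X * Θᵀ)ᵀ * X) := by
    rw [sampleCov, Matrix.mul_smul, transpose_mul, transpose_transpose, Matrix.mul_assoc]
  rw [h, Matrix.smul_apply, smul_eq_mul, mul_apply]
  rfl

theorem mul_sampleCov_mul_transpose_apply (X : Matrix (Fin N) (Fin n) ℝ)
    (Θ : Matrix (Fin n) (Fin n) ℝ) (j : Fin n) :
    (Θ * sampleCov X * Θᵀ) j j = 1 / (N : ℝ) * ∑ i, (X * Θᵀ) i j ^ 2 := by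
  have h : Θ * sampleCov X * Θᵀ = sampleCov (X * Θᵀ) := by
    rw [sampleCov, sampleCov, Matrix.mul_smul, Matrix.smul_mul, transpose_mul,
      transpose_transpose]
    simp only [Matrix.mul_assoc]
  simp only [h, sampleCov_apply, sq]

theorem ClimeFeasible.abs_mulVec_le {mu : ℝ} (h : ClimeFeasible X mu Θ) (v : Fin n → ℝ)
    (j : Fin n) : |((Θ * sampleCov X - 1) *ᵥ v) j| ≤ mu * l1 v := by
  rw [mulVec, dotProduct, l1, Finset.mul_sum]
  refine (Finset.abs_sum_le_sum_abs _ _).trans (Finset.sum_le_sum fun b _ => ?_)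
  rw [abs_mul]
  exact mul_le_mul_of_nonneg_right (h j b) (abs_nonneg _)

/-- Feasibility keeps `(Θ Σ_N)_jj` away from zero; Cauchy–Schwarz in the inner product of `Σ_N`
turns this into a lower bound on the variance. -/
theorem ClimeFeasible.variance_lower_bound {mu B : ℝ} (h : ClimeFeasible X mu Θ)
    (hmu : mu ≤ 1 / 2) {j : Fin n} (hB : sampleCov X j j ≤ B) (hB0 : 0 < B) :
    1 / (4 * B) ≤ (Θ * sampleCov X * Θᵀ) j j := by
  have hdiag : 1 / 2 ≤ (Θ * sampleCov X) j j := by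
    have := (abs_le.1 (h j j)).1
    rw [Matrix.sub_apply, one_apply_eq] at this
    linarith
  have hcs := Finset.sum_mul_sq_le_sq_mul_sq Finset.univ (fun i => (X * Θᵀ) i j) fun i => X i j
  rw [mul_sampleCov_apply] at hdiag
  rw [mul_sampleCov_mul_transpose_apply, div_le_iff₀ (by positivity)]
  set V := 1 / (N : ℝ) * ∑ i, (X * Θᵀ) i j ^ 2 with hV
  have : (1 / 2) ^ 2 ≤ V * B := by
    calc (1 / 2 : ℝ) ^ 2 ≤ (1 / (N : ℝ) * ∑ i, (X * Θᵀ) i j * X i j) ^ 2 := by gcongr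
      _ = (1 / (N : ℝ)) ^ 2 * (∑ i, (X * Θᵀ) i j * X i j) ^ 2 := by ring
      _ ≤ (1 / (N : ℝ)) ^ 2 * ((∑ i, (X * Θᵀ) i j ^ 2) * ∑ i, X i j ^ 2) := by gcongr
      _ = V * sampleCov X j j := by
          simp only [sampleCov_apply, hV, ← sq]
          ring
      _ ≤ V * B := by gcongr
  linarith

theorem oneStep_sub (β b : Fin n → ℝ) (ε : Fin N → ℝ) (j : Fin n) :
    oneStep X (response X β ε) Θ b j - β j
      = 1 / (N : ℝ) * ∑ i, (X * Θᵀ) i j * ε i - ((Θ * sampleCov X - 1) *ᵥ (b - β)) j := by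
  have hbias : (Θ * sampleCov X - 1) *ᵥ (b - β)
      = (1 / (N : ℝ)) • (Θ *ᵥ (Xᵀ *ᵥ (X *ᵥ (b - β)))) - (b - β) := by
    rw [sub_mulVec, one_mulVec, sampleCov, Matrix.mul_smul, smul_mulVec]
    simp only [mulVec_mulVec]
  have hnoise : ∑ i, (X * Θᵀ) i j * ε i = (Θ *ᵥ (Xᵀ *ᵥ ε)) j := by
    rw [mulVec_mulVec, ← transpose_transpose (Θ * Xᵀ), transpose_mul, transpose_transpose]
    rfl
  rw [hbias, hnoise, oneStep, response_sub_mulVec, mulVec_sub, mulVec_sub]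
  simp only [Pi.add_apply, Pi.smul_apply, Pi.sub_apply, smul_eq_mul]
  ring

theorem abs_sqrt_average_sub_sq_sub_le (u v : Fin N → ℝ) :
    |√(1 / (N : ℝ) * ∑ i, (u i - v i) ^ 2) - √(1 / (N : ℝ) * ∑ i, u i ^ 2)|
      ≤ √(1 / (N : ℝ) * ∑ i, v i ^ 2) := by
  have hscale : ∀ w : Fin N → ℝ, √(1 / (N : ℝ) * ∑ i, w i ^ 2)
      = √(1 / (N : ℝ)) * ‖WithLp.toLp 2 w‖ := fun w => by
    rw [norm_toLp_eq_l2, Real.sqrt_mul (by positivity), l2]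
  have htri := abs_norm_sub_norm_le (WithLp.toLp 2 (u - v)) (WithLp.toLp 2 u)
  rw [← WithLp.toLp_sub, sub_sub_cancel_left, WithLp.toLp_neg, norm_neg] at htri
  have hdiff := hscale (u - v)
  simp only [Pi.sub_apply] at hdiff
  rw [hscale v, hscale u, hdiff, ← mul_sub, abs_mul, abs_of_nonneg (Real.sqrt_nonneg _)]
  exact mul_le_mul_of_nonneg_left htri (Real.sqrt_nonneg _)

theorem abs_residualStd_sub_le (β b : Fin n → ℝ) (ε : Fin N → ℝ) :
    |residualStd X (response X β ε) b - √(1 / (N : ℝ) * ∑ i, ε i ^ 2)|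
      ≤ √(1 / (N : ℝ) * ∑ i, (X *ᵥ (b - β)) i ^ 2) := by
  have hres : ∀ i, response X β ε i - (X *ᵥ b) i = ε i - (X *ᵥ (b - β)) i := fun i =>
    congrFun (response_sub_mulVec X β b ε) i
  simp only [residualStd, hres]
  exact abs_sqrt_average_sub_sq_sub_le _ _

/-- The normalization of `v` to Euclidean norm one. The vector `0` is sent to a constant vector of
norm one, so that Gaussian sums with these weights are standard Gaussian without exception. -/
noncomputable def unitWeight (v : Fin N → ℝ) (i : Fin N) : ℝ :=
  if v = 0 then 1 / √(N : ℝ) else v i / l2 v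

theorem sum_unitWeight_sq (hN : 0 < N) (v : Fin N → ℝ) : ∑ i, unitWeight v i ^ 2 = 1 := by
  unfold unitWeight
  split_ifs with hv
  · simp [hN.ne']
  · simp only [div_pow, ← Finset.sum_div, ← l2_sq]
    exact div_self (pow_ne_zero 2 ((l2_eq_zero_iff v).not.2 hv))

theorem measurable_unitWeight (i : Fin N) : Measurable fun v : Fin N → ℝ => unitWeight v i := by
  unfold unitWeight l2
  exact Measurable.ite (measurableSet_singleton 0) measurable_const (by fun_prop)

theorem sum_mul_eq_l2_mul_sum_unitWeight (v ε : Fin N → ℝ) {σ : ℝ} (hσ : σ ≠ 0) :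
    ∑ i, v i * ε i = l2 v * σ * ∑ i, unitWeight v i * (ε i / σ) := by
  by_cases hv : v = 0
  · simp [hv, l2]
  · have : l2 v ≠ 0 := (l2_eq_zero_iff v).not.2 hv
    rw [Finset.mul_sum]
    refine Finset.sum_congr rfl fun i _ => ?_
    rw [unitWeight, if_neg hv]
    field_simp

/-- The leading term of the studentized statistic: a Gaussian sum with unit weights that depend on
the design only. -/
noncomputable def leadingTerm (X : Matrix (Fin N) (Fin n) ℝ) (Θ : Matrix (Fin n) (Fin n) ℝ)
    (j : Fin n) (σ : ℝ) (ε : Fin N → ℝ) : ℝ :=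
  ∑ i, unitWeight (fun i => (X * Θᵀ) i j) i * (ε i / σ)

theorem sqrt_mul_oneStep_sub {σ : ℝ} (hσ : σ ≠ 0) (β b : Fin n → ℝ)
    (ε : Fin N → ℝ) (j : Fin n) :
    √(N : ℝ) * (oneStep X (response X β ε) Θ b j - β j)
      = √((Θ * sampleCov X * Θᵀ) j j) * σ * leadingTerm X Θ j σ ε
        - √(N : ℝ) * ((Θ * sampleCov X - 1) *ᵥ (b - β)) j := by
  have hl2 : √(N : ℝ) * (1 / N * l2 fun i => (X * Θᵀ) i j)
      = √((Θ * sampleCov X * Θᵀ) j j) := by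
    rw [mul_sampleCov_mul_transpose_apply, l2, Real.sqrt_mul (by positivity), ← mul_assoc,
      Real.sqrt_div zero_le_one, Real.sqrt_one, mul_one_div, Real.sqrt_div_self']
  rw [oneStep_sub, sum_mul_eq_l2_mul_sum_unitWeight _ _ hσ, ← hl2, leadingTerm]
  ring

/-- Writing `ρ` for the ratio of the estimated to the true noise level, the difference is
`(Z (1 - ρ) - R) / ρ` with the leading term `Z` and the rescaled bias `R`. -/
theorem abs_div_sub_le {Z R ρ B κ₁ κ₂ : ℝ} (hZ : |Z| ≤ B) (hρ : |ρ - 1| ≤ κ₁) (hκ₁ : κ₁ ≤ 1 / 2)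
    (hR : |R| ≤ κ₂) : |(Z - R) / ρ - Z| ≤ 2 * (B * κ₁ + κ₂) := by
  have hρ_half : 1 / 2 ≤ ρ := by linarith [(abs_le.1 hρ).1]
  have hρ_pos : 0 < ρ := by linarith
  have hB : 0 ≤ B := (abs_nonneg Z).trans hZ
  have hprod : |Z * (1 - ρ)| ≤ B * κ₁ := by
    rw [abs_mul, abs_sub_comm 1 ρ]
    gcongr
  have hsum : |Z * (1 - ρ) - R| ≤ B * κ₁ + κ₂ := (abs_sub _ _).trans (add_le_add hprod hR)
  have hdiff : (Z - R) / ρ - Z = (Z * (1 - ρ) - R) / ρ := by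
    field_simp
    ring
  rw [hdiff, abs_div, abs_of_pos hρ_pos, div_le_iff₀ hρ_pos]
  calc |Z * (1 - ρ) - R| ≤ 2 * (B * κ₁ + κ₂) * (1 / 2) := by linarith
    _ ≤ 2 * (B * κ₁ + κ₂) * ρ := by
        have := (abs_nonneg _).trans hsum
        gcongr

theorem abs_studentized_sub_leadingTerm_le {σ : ℝ} (hσ : 0 < σ) {β b : Fin n → ℝ}
    {ε : Fin N → ℝ} {j : Fin n} {B κ₁ κ₂ v mu : ℝ} (hv : 0 < v)
    (hfeas : ClimeFeasible X mu Θ) (hvar : v ≤ (Θ * sampleCov X * Θᵀ) j j)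
    (hZ : |leadingTerm X Θ j σ ε| ≤ B)
    (hκ₁ : |residualStd X (response X β ε) b / σ - 1| ≤ κ₁) (hκ : κ₁ ≤ 1 / 2)
    (hκ₂ : √(N : ℝ) * (mu * l1 (b - β)) ≤ κ₂ * (σ * √v)) :
    |studentized X (response X β ε) Θ b β j - leadingTerm X Θ j σ ε| ≤ 2 * (B * κ₁ + κ₂) := by
  rw [studentized, sqrt_mul_oneStep_sub hσ.ne']
  set V := (Θ * sampleCov X * Θᵀ) j j
  set e := ((Θ * sampleCov X - 1) *ᵥ (b - β)) j
  set sd := residualStd X (response X β ε) b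
  have hsv : 0 < √v := Real.sqrt_pos.2 hv
  have hsV : 0 < √V := hsv.trans_le (Real.sqrt_le_sqrt hvar)
  have hbias : |√(N : ℝ) * e / (σ * √V)| ≤ κ₂ := by
    have hle : √(N : ℝ) * |e| ≤ κ₂ * (σ * √v) :=
      (mul_le_mul_of_nonneg_left (hfeas.abs_mulVec_le _ _) (Real.sqrt_nonneg _)).trans hκ₂
    have hκ₂0 : 0 ≤ κ₂ :=
      nonneg_of_mul_nonneg_left ((by positivity : (0 : ℝ) ≤ _).trans hle) (mul_pos hσ hsv)
    rw [abs_div, abs_of_pos (mul_pos hσ hsV), div_le_iff₀ (mul_pos hσ hsV), abs_mul,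
      abs_of_nonneg (Real.sqrt_nonneg _)]
    exact hle.trans (by gcongr)
  have hratio : (√V * σ * leadingTerm X Θ j σ ε - √(N : ℝ) * e) / (sd * √V)
      = (leadingTerm X Θ j σ ε - √(N : ℝ) * e / (σ * √V)) / (sd / σ) := by
    field_simp
  rw [hratio]
  exact abs_div_sub_le hZ hκ₁ hκ hbias

end OneStep

section Measurability

variable {Ω : Type*} [MeasurableSpace Ω] {P : Measure Ω}

theorem aemeasurable_mulVec {m k : Type*} [Fintype k] {A : Ω → Matrix m k ℝ} {v : Ω → k → ℝ}
    (hA : ∀ i a, AEMeasurable (fun ω => A ω i a) P) (hv : ∀ a, AEMeasurable (fun ω => v ω a) P)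
    (i : m) : AEMeasurable (fun ω => (A ω *ᵥ v ω) i) P :=
  Finset.aemeasurable_fun_sum _ fun a _ => (hA i a).mul (hv a)

theorem aemeasurable_matrix_mul {l m k : Type*} [Fintype m] {A : Ω → Matrix l m ℝ}
    {B : Ω → Matrix m k ℝ} (hA : ∀ i a, AEMeasurable (fun ω => A ω i a) P)
    (hB : ∀ i a, AEMeasurable (fun ω => B ω i a) P) (i : l) (a : k) :
    AEMeasurable (fun ω => (A ω * B ω) i a) P :=
  Finset.aemeasurable_fun_sum _ fun c _ => (hA i c).mul (hB c a)

variable {N n : ℕ} {X : Ω → Matrix (Fin N) (Fin n) ℝ} {y : Ω → Fin N → ℝ}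
  {Θ : Ω → Matrix (Fin n) (Fin n) ℝ} {b : Ω → Fin n → ℝ}

theorem aemeasurable_residualStd (hX : ∀ i a, AEMeasurable (fun ω => X ω i a) P)
    (hy : ∀ i, AEMeasurable (fun ω => y ω i) P) (hb : ∀ a, AEMeasurable (fun ω => b ω a) P) :
    AEMeasurable (fun ω => residualStd (X ω) (y ω) (b ω)) P :=
  ((Finset.aemeasurable_fun_sum Finset.univ fun i _ =>
    ((hy i).sub (aemeasurable_mulVec hX hb i)).pow_const 2).const_mul (1 / (N : ℝ))).sqrt

theorem aemeasurable_variance (hX : ∀ i a, AEMeasurable (fun ω => X ω i a) P)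
    (hΘ : ∀ a c, AEMeasurable (fun ω => Θ ω a c) P) (j : Fin n) :
    AEMeasurable (fun ω => (Θ ω * sampleCov (X ω) * (Θ ω)ᵀ) j j) P := by
  simp only [mul_sampleCov_mul_transpose_apply]
  have hΘt : ∀ a c, AEMeasurable (fun ω => (Θ ω)ᵀ a c) P := fun a c => hΘ c a
  exact (Finset.aemeasurable_fun_sum _ fun i _ =>
    (aemeasurable_matrix_mul hX hΘt i j).pow_const 2).const_mul _

theorem aemeasurable_oneStep (hX : ∀ i a, AEMeasurable (fun ω => X ω i a) P)
    (hy : ∀ i, AEMeasurable (fun ω => y ω i) P) (hΘ : ∀ a c, AEMeasurable (fun ω => Θ ω a c) P)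
    (hb : ∀ a, AEMeasurable (fun ω => b ω a) P) (j : Fin n) :
    AEMeasurable (fun ω => oneStep (X ω) (y ω) (Θ ω) (b ω) j) P := by
  have hXt : ∀ a i, AEMeasurable (fun ω => (X ω)ᵀ a i) P := fun a i => hX i a
  have hscore := aemeasurable_mulVec hXt fun i => (hy i).sub (aemeasurable_mulVec hX hb i)
  exact (hb j).add ((aemeasurable_mulVec hΘ hscore j).const_mul (1 / (N : ℝ)))

theorem aemeasurable_studentized (hX : ∀ i a, AEMeasurable (fun ω => X ω i a) P)
    (hy : ∀ i, AEMeasurable (fun ω => y ω i) P) (hΘ : ∀ a c, AEMeasurable (fun ω => Θ ω a c) P)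
    (hb : ∀ a, AEMeasurable (fun ω => b ω a) P) (β : Fin n → ℝ) (j : Fin n) :
    AEMeasurable (fun ω => studentized (X ω) (y ω) (Θ ω) (b ω) β j) P :=
  (((aemeasurable_oneStep hX hy hΘ hb j).sub_const (β j)).const_mul √(N : ℝ)).div
    ((aemeasurable_residualStd hX hy hb).mul (aemeasurable_variance hX hΘ j).sqrt)

end Measurability

section Spectrum

open scoped MatrixOrder

variable {ι : Type} [Fintype ι]

theorem dotProduct_mulVec_le_of_le {A B : Matrix ι ι ℝ} (h : A ≤ B) (v : ι → ℝ) :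
    v ⬝ᵥ (A *ᵥ v) ≤ v ⬝ᵥ (B *ᵥ v) := by
  have := (Matrix.le_iff.1 h).dotProduct_mulVec_nonneg v
  rwa [star_trivial, sub_mulVec, dotProduct_sub, sub_nonneg] at this

variable [DecidableEq ι] {S : Matrix ι ι ℝ} {c c' : ℝ}

theorem dotProduct_algebraMap_mulVec (r : ℝ) (v : ι → ℝ) :
    v ⬝ᵥ (algebraMap ℝ (Matrix ι ι ℝ) r *ᵥ v) = r * l2 v ^ 2 := by
  rw [Algebra.algebraMap_eq_smul_one, smul_mulVec, one_mulVec, dotProduct_smul, smul_eq_mul,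
    l2_sq, dotProduct]
  simp only [sq]

theorem mul_l2_sq_le_of_spectrum (hS : S.IsHermitian) (hspec : ∀ x ∈ spectrum ℝ S, c ≤ x)
    (v : ι → ℝ) : c * l2 v ^ 2 ≤ v ⬝ᵥ (S *ᵥ v) := by
  rw [← dotProduct_algebraMap_mulVec]
  exact dotProduct_mulVec_le_of_le (algebraMap_le_of_le_spectrum hspec hS) v

theorem dotProduct_mulVec_le_of_spectrum (hS : S.IsHermitian)
    (hspec : ∀ x ∈ spectrum ℝ S, x ≤ c') (v : ι → ℝ) : v ⬝ᵥ (S *ᵥ v) ≤ c' * l2 v ^ 2 := by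
  rw [← dotProduct_algebraMap_mulVec]
  exact dotProduct_mulVec_le_of_le (le_algebraMap_of_spectrum_le hspec hS) v

theorem apply_self_le_of_spectrum (hS : S.IsHermitian) (hspec : ∀ x ∈ spectrum ℝ S, x ≤ c')
    (a : ι) : S a a ≤ c' := by
  have h := dotProduct_mulVec_le_of_spectrum hS hspec (Pi.single a 1)
  simpa [l2_sq, Pi.single_apply] using h

theorem isUnit_det_of_spectrum_pos (hspec : ∀ x ∈ spectrum ℝ S, 0 < x) : IsUnit S.det :=
  (isUnit_iff_isUnit_det S).1 <|
    (spectrum.zero_notMem_iff ℝ).1 fun h => (hspec 0 h).false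

theorem mulVec_inv_apply (hS : S.IsHermitian) (hu : IsUnit S.det) (a : ι) :
    S *ᵥ S⁻¹ a = Pi.single a 1 := by
  have hrow : S⁻¹ a = S⁻¹ *ᵥ Pi.single a 1 := by
    ext b
    rw [mulVec_single_one, col_apply, ← hS.inv.apply b a, star_trivial]
  rw [hrow, mulVec_mulVec, mul_nonsing_inv S hu, one_mulVec]

theorem inv_apply_dotProduct_mulVec (hS : S.IsHermitian) (hu : IsUnit S.det) (a : ι) :
    S⁻¹ a ⬝ᵥ (S *ᵥ S⁻¹ a) = S⁻¹ a a := by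
  rw [mulVec_inv_apply hS hu, dotProduct_single_one]

theorem l2_inv_apply_le (hS : S.IsHermitian) (hc : 0 < c) (hspec : ∀ x ∈ spectrum ℝ S, c ≤ x)
    (a : ι) : l2 (S⁻¹ a) ≤ 1 / c := by
  have hq := mul_l2_sq_le_of_spectrum hS hspec (S⁻¹ a)
  rw [inv_apply_dotProduct_mulVec hS
    (isUnit_det_of_spectrum_pos fun x hx => hc.trans_le (hspec x hx))] at hq
  have hentry : S⁻¹ a a ≤ l2 (S⁻¹ a) := by
    refine Real.le_sqrt_of_sq_le ?_
    exact Finset.single_le_sum (f := fun b => S⁻¹ a b ^ 2) (fun _ _ => sq_nonneg _)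
      (Finset.mem_univ a)
  rcases (l2_nonneg (S⁻¹ a)).eq_or_lt with h0 | h0
  · rw [← h0]
    positivity
  · rw [le_div_iff₀' hc]
    exact le_of_mul_le_mul_right (by linarith) h0

/-- Evaluates the quadratic form of `S` at `S⁻¹ e_a - c'⁻¹ e_a`. -/
theorem one_div_le_inv_apply_self (hS : S.IsHermitian) (hc' : 0 < c')
    (hpos : ∀ x ∈ spectrum ℝ S, 0 < x) (hspec : ∀ x ∈ spectrum ℝ S, x ≤ c') (a : ι) :
    1 / c' ≤ S⁻¹ a a := by
  have hu := isUnit_det_of_spectrum_pos hpos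
  have hquad := mul_l2_sq_le_of_spectrum hS (fun x hx => (hpos x hx).le)
    (S⁻¹ a - Pi.single a (1 / c'))
  have hcross : S⁻¹ a ⬝ᵥ (S *ᵥ Pi.single a (1 / c')) = 1 / c' := by
    rw [dotProduct_mulVec, ← mulVec_transpose, ← conjTranspose_eq_transpose_of_trivial, hS.eq,
      mulVec_inv_apply hS hu, single_one_dotProduct, Pi.single_eq_same]
  have hdiag : Pi.single a (1 / c') ⬝ᵥ (S *ᵥ Pi.single a (1 / c')) ≤ 1 / c' := by
    have := dotProduct_mulVec_le_of_spectrum hS hspec (Pi.single a (1 / c'))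
    rw [l2_sq] at this
    simp only [Pi.single_apply, ite_pow, zero_pow two_ne_zero, Finset.sum_ite_eq',
      Finset.mem_univ, if_true] at this
    calc _ ≤ c' * (1 / c') ^ 2 := by simpa only [Pi.single_apply] using this
      _ = 1 / c' := by field_simp
  rw [mulVec_sub, dotProduct_sub, sub_dotProduct, sub_dotProduct,
    inv_apply_dotProduct_mulVec hS hu, hcross, mulVec_inv_apply hS hu, dotProduct_single_one,
    Pi.single_eq_same, zero_mul] at hquad
  linarith

end Spectrum

section Concentration

variable {Ω : Type*} [MeasurableSpace Ω] {P : Measure Ω}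

theorem hasSubgaussianMGF_mono {Y : Ω → ℝ} {c c' : NNReal} (h : HasSubgaussianMGF Y c P)
    (hc : c ≤ c') : HasSubgaussianMGF Y c' P :=
  ⟨h.integrable_exp_mul, fun t => (h.mgf_le t).trans (Real.exp_le_exp.2 (by gcongr))⟩

theorem hasSubgaussianMGF_of_hasLaw_gaussianReal {Z : Ω → ℝ} {v : NNReal}
    (h : HasLaw Z (gaussianReal 0 v) P) : HasSubgaussianMGF Z v P where
  integrable_exp_mul t := by
    have := integrable_exp_mul_gaussianReal (μ := 0) (v := v) t
    rw [← h.map_eq] at this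
    exact this.comp_aemeasurable h.aemeasurable
  mgf_le t := by rw [mgf_gaussianReal h.map_eq, zero_mul, zero_add]

theorem measureReal_abs_ge_le_of_hasSubgaussianMGF [IsFiniteMeasure P] {Z : Ω → ℝ} {c : NNReal}
    (h : HasSubgaussianMGF Z c P) {x : ℝ} (hx : 0 ≤ x) :
    P.real {ω | x ≤ |Z ω|} ≤ 2 * Real.exp (-(x ^ 2 / (2 * c))) := by
  have hsub : {ω | x ≤ |Z ω|} ⊆ {ω | x ≤ Z ω} ∪ {ω | x ≤ (-Z) ω} := by
    intro ω hω
    simpa [le_abs] using hω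
  calc P.real {ω | x ≤ |Z ω|}
      ≤ P.real {ω | x ≤ Z ω} + P.real {ω | x ≤ (-Z) ω} :=
        (measureReal_mono hsub).trans (measureReal_union_le _ _)
    _ ≤ Real.exp (-x ^ 2 / (2 * c)) + Real.exp (-x ^ 2 / (2 * c)) :=
        add_le_add (h.measure_ge_le hx) (h.neg.measure_ge_le hx)
    _ = 2 * Real.exp (-(x ^ 2 / (2 * c))) := by rw [← two_mul, neg_div]

theorem measureReal_abs_ge_le_of_hasLaw [IsFiniteMeasure P] {Z : Ω → ℝ}
    (h : HasLaw Z (gaussianReal 0 1) P) {x : ℝ} (hx : 0 ≤ x) :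
    P.real {ω | x ≤ |Z ω|} ≤ 2 * Real.exp (-(x ^ 2 / 2)) := by
  simpa using measureReal_abs_ge_le_of_hasSubgaussianMGF
    (hasSubgaussianMGF_of_hasLaw_gaussianReal h) hx

theorem measureReal_exists_le {ι : Type*} [Fintype ι] {p : ι → Ω → Prop} {B : ℝ}
    (h : ∀ i, P.real {ω | p i ω} ≤ B) : P.real {ω | ∃ i, p i ω} ≤ Fintype.card ι * B := by
  rw [Set.ofPred_exists]
  refine (measureReal_iUnion_fintype_le _).trans ((Finset.sum_le_sum fun i _ => h i).trans_eq ?_)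
  rw [Finset.sum_const, nsmul_eq_mul, Finset.card_univ]

theorem natCast_mul_two_mul_exp_neg_le {n : ℕ} (hn : 0 < n) {q y : ℝ}
    (hy : (1 + q) * Real.log n ≤ y) :
    (n : ℝ) * (2 * Real.exp (-y)) ≤ 2 * Real.exp (-(q * Real.log n)) := by
  have hn' : (0 : ℝ) < n := Nat.cast_pos.2 hn
  calc (n : ℝ) * (2 * Real.exp (-y)) = 2 * Real.exp (Real.log n + -y) := by
        rw [Real.exp_add, Real.exp_log hn']
        ring
    _ ≤ 2 * Real.exp (-(q * Real.log n)) := by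
        gcongr
        linarith

theorem measureReal_exists_abs_ge_le_of_hasLaw [IsFiniteMeasure P] {n : ℕ} (hn : 0 < n)
    {Z : Fin n → Ω → ℝ} (hZ : ∀ a, HasLaw (Z a) (gaussianReal 0 1) P) {x q : ℝ} (hx : 0 ≤ x)
    (hq : 2 * (1 + q) ≤ x ^ 2) :
    P.real {ω | ∃ a, x * √(Real.log n) ≤ |Z a ω|} ≤ 2 * Real.exp (-(q * Real.log n)) := by
  have hlog : 0 ≤ Real.log n := Real.log_natCast_nonneg n
  refine (measureReal_exists_le fun a =>
    measureReal_abs_ge_le_of_hasLaw (hZ a) (by positivity)).trans ?_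
  rw [Fintype.card_fin]
  refine natCast_mul_two_mul_exp_neg_le hn ?_
  rw [mul_pow, Real.sq_sqrt hlog, mul_div_right_comm]
  gcongr
  linarith

theorem measureReal_exists_abs_average_mul_sub_ge_le {N n : ℕ} (hN : 0 < N) (hn : 0 < n)
    {U V : Fin n → Fin N → Ω → ℝ} {m : Fin n → Fin n → ℝ} {c : NNReal} (hc : 0 < c)
    (hind : ∀ a b, iIndepFun (fun i ω => U a i ω * V b i ω) P)
    (hU : ∀ a i, HasSubgaussianMGF (U a i) c P) (hV : ∀ b i, HasSubgaussianMGF (V b i) c P)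
    (hm : ∀ a b i, ∫ ω, U a i ω * V b i ω ∂P = m a b) {τ q : ℝ} (hτ : 0 ≤ τ)
    (hq : (2 + q) * (512 * √2 * c ^ 2) ≤ τ ^ 2) (hτc : τ * √(Real.log n / N) ≤ 32 * √2 * c) :
    P.real {ω | ∃ a b, τ * √(Real.log n / N) ≤ |1 / (N : ℝ) * ∑ i, U a i ω * V b i ω - m a b|}
      ≤ 2 * Real.exp (-(q * Real.log n)) := by
  have : (0 : ℝ) < c := hc
  have : 0 ≤ Real.log n := Real.log_natCast_nonneg n
  have hunion := measureReal_exists_le fun a => measureReal_exists_le fun b =>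
    measureReal_abs_average_mul_sub_ge_le hN hc (hind a b) (hU a) (hV b) (hm a b)
      (mul_nonneg hτ (Real.sqrt_nonneg _)) hτc
  rw [Fintype.card_fin] at hunion
  refine hunion.trans ((mul_le_mul_of_nonneg_left
    (natCast_mul_two_mul_exp_neg_le (q := 1 + q) hn ?_) (Nat.cast_nonneg n)).trans
    (natCast_mul_two_mul_exp_neg_le hn le_rfl))
  calc (1 + (1 + q)) * Real.log n = (2 + q) * Real.log n := by ring
    _ ≤ τ ^ 2 / (512 * √2 * c ^ 2) * Real.log n := by
        gcongr
        rwa [le_div_iff₀ (by positivity)]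
    _ = N * (τ * √(Real.log n / N)) ^ 2 / (512 * √2 * c ^ 2) := by
        rw [mul_pow, Real.sq_sqrt (by positivity)]
        field

end Concentration

namespace IsGaussianNoise

variable {Ω : Type*} [MeasurableSpace Ω] {P : Measure Ω} {N : ℕ} {σ : ℝ} {ε : Ω → Fin N → ℝ}

theorem hasLaw_div (h : IsGaussianNoise σ ε P) (hσ : 0 < σ) (i : Fin N) :
    HasLaw (fun ω => ε ω i / σ) (gaussianReal 0 1) P := by
  simpa [Pi.single_apply] using
    h.hasLaw_sum hσ (w := Pi.single i 1) (by simp [Pi.single_apply])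

theorem integral_div_mul_div (h : IsGaussianNoise σ ε P) (hσ : 0 < σ) (i : Fin N) :
    ∫ ω, ε ω i / σ * (ε ω i / σ) ∂P = 1 := by
  have hl := h.hasLaw_div hσ i
  have hmean : ∫ ω, ε ω i / σ ∂P = 0 := hl.integral_eq.trans integral_id_gaussianReal
  have hvar := hl.variance_eq
  rw [variance_id_gaussianReal, variance_of_integral_eq_zero hl.aemeasurable hmean] at hvar
  simpa [sq] using hvar

theorem measureReal_abs_average_sq_sub_one_ge_le (h : IsGaussianNoise σ ε P) (hσ : 0 < σ)
    (hN : 0 < N) {u : ℝ} (hu : 0 ≤ u) (hu' : u ≤ 32 * √2) :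
    P.real {ω | u ≤ |1 / (N : ℝ) * ∑ i, (ε ω i / σ) ^ 2 - 1|}
      ≤ 2 * Real.exp (-(N * u ^ 2 / (512 * √2))) := by
  have hsub := fun i => hasSubgaussianMGF_of_hasLaw_gaussianReal (h.hasLaw_div hσ i)
  have hind : iIndepFun (fun i ω => ε ω i / σ * (ε ω i / σ)) P :=
    h.indep.comp (fun _ y => y / σ * (y / σ)) fun _ => by fun_prop
  simpa [sq] using measureReal_abs_average_mul_sub_ge_le hN one_pos hind hsub hsub
    (h.integral_div_mul_div hσ) hu (by simpa using hu')

end IsGaussianNoise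

section Design

variable {Ω : Type*} [MeasurableSpace Ω] {P : Measure Ω} {N n : ℕ} {σ : ℝ}

namespace IsSubGaussianVec

variable [IsProbabilityMeasure P] {Y : Ω → Fin n → ℝ} {c : NNReal}

theorem hasSubgaussianMGF_sum (h : IsSubGaussianVec σ Y P) {v : Fin n → ℝ}
    (hv : σ ^ 2 * l2 v ^ 2 ≤ c) : HasSubgaussianMGF (fun ω => ∑ a, v a * Y ω a) c P := by
  rcases (l2_nonneg v).eq_or_lt with h0 | h0
  · simp only [(l2_eq_zero_iff v).1 h0.symm, Pi.zero_apply, zero_mul, Finset.sum_const_zero]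
    exact hasSubgaussianMGF_mono HasSubgaussianMGF.fun_zero zero_le
  · have hunit : ∑ a, (v a / l2 v) ^ 2 = 1 := by
      simp only [div_pow, ← Finset.sum_div]
      rw [← l2_sq, div_self (pow_pos h0 2).ne']
    have hscale : (fun ω => l2 v * ∑ a, v a / l2 v * Y ω a) = fun ω => ∑ a, v a * Y ω a := by
      ext ω
      rw [Finset.mul_sum]
      exact Finset.sum_congr rfl fun a _ => by field
    have hsub := (h.2 _ hunit).2.const_mul (l2 v)
    rw [hscale] at hsub
    refine hasSubgaussianMGF_mono hsub (NNReal.coe_le_coe.1 ?_)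
    change l2 v ^ 2 * (Real.toNNReal (σ ^ 2) : ℝ) ≤ c
    rwa [Real.coe_toNNReal _ (sq_nonneg σ), mul_comm]

theorem hasSubgaussianMGF_apply (h : IsSubGaussianVec σ Y P) (hc : σ ^ 2 ≤ c) (a : Fin n) :
    HasSubgaussianMGF (fun ω => Y ω a) c P := by
  simpa [Pi.single_apply] using
    h.hasSubgaussianMGF_sum (v := Pi.single a 1) (by simpa [l2_sq, Pi.single_apply] using hc)

end IsSubGaussianVec

namespace IsSubGaussianDesign

variable {S : Matrix (Fin n) (Fin n) ℝ} {X : Ω → Fin N → Fin n → ℝ}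

theorem isHermitian (h : IsSubGaussianDesign σ S X P) (hN : 0 < N) : S.IsHermitian := by
  ext a b
  rw [conjTranspose_apply, star_trivial, ← h.covariance ⟨0, hN⟩ b a, covariance_comm,
    h.covariance]

theorem iIndepFun_mul (h : IsSubGaussianDesign σ S X P) (u v : Fin n → ℝ) :
    iIndepFun (fun i ω => (∑ a, u a * X ω i a) * ∑ a, v a * X ω i a) P :=
  h.indep.comp (fun _ (y : Fin n → ℝ) => (∑ a, u a * y a) * ∑ a, v a * y a) fun _ => by fun_prop

variable [IsProbabilityMeasure P]

theorem memLp_two (h : IsSubGaussianDesign σ S X P) (i : Fin N) (a : Fin n) :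
    MemLp (fun ω => X ω i a) 2 P :=
  ((h.subGaussian i).hasSubgaussianMGF_apply (Real.le_coe_toNNReal (σ ^ 2)) a).memLp 2

theorem integral_mul (h : IsSubGaussianDesign σ S X P) (i : Fin N) (a b : Fin n) :
    ∫ ω, X ω i a * X ω i b ∂P = S a b := by
  rw [← h.covariance i a b, covariance_eq_sub (h.memLp_two i a) (h.memLp_two i b),
    (h.subGaussian i).1 a, zero_mul, sub_zero]
  rfl

theorem integral_sum_mul (h : IsSubGaussianDesign σ S X P) (i : Fin N) (v : Fin n → ℝ)
    (b : Fin n) : ∫ ω, (∑ a, v a * X ω i a) * X ω i b ∂P = ∑ a, v a * S a b := by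
  simp only [Finset.sum_mul, mul_assoc]
  have hint : ∀ a, Integrable (fun ω => v a * (X ω i a * X ω i b)) P := fun a =>
    ((h.memLp_two i a).integrable_mul (h.memLp_two i b)).const_mul (v a)
  rw [integral_finsetSum _ fun a _ => hint a]
  exact Finset.sum_congr rfl fun a _ => by rw [integral_const_mul, h.integral_mul]

theorem measureReal_exists_abs_sampleCov_sub_ge_le (h : IsSubGaussianDesign σ S X P) (hN : 0 < N)
    (hn : 0 < n) {c : NNReal} (hc : 0 < c) (hσc : σ ^ 2 ≤ c) {τ q : ℝ} (hτ : 0 ≤ τ)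
    (hq : (2 + q) * (512 * √2 * c ^ 2) ≤ τ ^ 2) (hτc : τ * √(Real.log n / N) ≤ 32 * √2 * c) :
    P.real {ω | ∃ a b, τ * √(Real.log n / N) ≤ |sampleCov (Matrix.of (X ω)) a b - S a b|}
      ≤ 2 * Real.exp (-(q * Real.log n)) := by
  have hsub := fun a i => (h.subGaussian i).hasSubgaussianMGF_apply hσc a
  have hind : ∀ a b, iIndepFun (fun i ω => X ω i a * X ω i b) P := fun a b => by
    simpa [Pi.single_apply] using h.iIndepFun_mul (Pi.single a 1) (Pi.single b 1)
  simpa only [sampleCov_apply, of_apply] using measureReal_exists_abs_average_mul_sub_ge_le hN hn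
    hc hind hsub hsub (fun a b i => h.integral_mul i a b) hτ hq hτc

theorem measureReal_exists_abs_inv_mul_sampleCov_sub_one_ge_le (h : IsSubGaussianDesign σ S X P)
    (hN : 0 < N) (hn : 0 < n) {κ : ℝ} (hκ : 0 < κ) (hspec : ∀ x ∈ spectrum ℝ S, κ ≤ x)
    {c : NNReal} (hc : 0 < c) (hσc : σ ^ 2 ≤ c) (hσκ : σ ^ 2 * (1 / κ) ^ 2 ≤ c) {τ q : ℝ}
    (hτ : 0 ≤ τ) (hq : (2 + q) * (512 * √2 * c ^ 2) ≤ τ ^ 2)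
    (hτc : τ * √(Real.log n / N) ≤ 32 * √2 * c) :
    P.real {ω | ∃ a b, τ * √(Real.log n / N) ≤ |(S⁻¹ * sampleCov (Matrix.of (X ω)) - 1) a b|}
      ≤ 2 * Real.exp (-(q * Real.log n)) := by
  have hu : IsUnit S.det := isUnit_det_of_spectrum_pos fun x hx => hκ.trans_le (hspec x hx)
  have hind : ∀ a b, iIndepFun (fun i ω => (∑ d, S⁻¹ a d * X ω i d) * X ω i b) P := fun a b => by
    simpa [Pi.single_apply] using h.iIndepFun_mul (S⁻¹ a) (Pi.single b 1)
  have hrow : ∀ a, σ ^ 2 * l2 (S⁻¹ a) ^ 2 ≤ c := fun a => by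
    refine le_trans ?_ hσκ
    have := l2_nonneg (S⁻¹ a)
    gcongr
    exact l2_inv_apply_le (h.isHermitian hN) hκ hspec a
  have hmean : ∀ a b i, ∫ ω, (∑ d, S⁻¹ a d * X ω i d) * X ω i b ∂P
      = (1 : Matrix (Fin n) (Fin n) ℝ) a b := fun a b i => by
    rw [h.integral_sum_mul, ← nonsing_inv_mul S hu, mul_apply]
  have htransform : ∀ ω i a, (Matrix.of (X ω) * S⁻¹ᵀ) i a = ∑ d, S⁻¹ a d * X ω i d :=
    fun ω i a => by
      rw [mul_apply]
      exact Finset.sum_congr rfl fun d _ => mul_comm _ _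
  simpa only [Matrix.sub_apply, mul_sampleCov_apply, htransform, of_apply] using
    measureReal_exists_abs_average_mul_sub_ge_le hN hn hc hind
      (fun a i => (h.subGaussian i).hasSubgaussianMGF_sum (hrow a))
      (fun a i => (h.subGaussian i).hasSubgaussianMGF_apply hσc a) hmean hτ hq hτc

end IsSubGaussianDesign

end Design

section GoodSample

theorem sqrt_log_div_mul_le {N n : ℕ} {s : ℝ} (hn : 2 ≤ n) (hs : 0 ≤ s) :
    √(Real.log n / N) * s ≤ 2 * (s * Real.log n / √(N : ℝ)) := by
  have hlog : 1 / 4 ≤ Real.log n := by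
    have hmono : Real.log 2 ≤ Real.log n := Real.log_le_log two_pos (by exact_mod_cast hn)
    linarith [Real.log_two_gt_d9]
  have hsqrt : √(Real.log n) ≤ 2 * Real.log n := by
    rw [Real.sqrt_le_left (by linarith)]
    nlinarith
  rw [Real.sqrt_div (by linarith)]
  calc √(Real.log n) / √(N : ℝ) * s ≤ 2 * Real.log n / √(N : ℝ) * s := by gcongr
    _ = 2 * (s * Real.log n / √(N : ℝ)) := by ring

theorem sqrt_mul_div_self (x L : ℝ) : √x * (L / x) = L / √x := by
  rw [mul_div_left_comm, Real.sqrt_div_self', mul_one_div]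

theorem sqrt_mul_sqrt_log_div_sq_mul (N n : ℕ) (s : ℝ) :
    √(N : ℝ) * (√(Real.log n / N) ^ 2 * s) = s * Real.log n / √(N : ℝ) := by
  have hlog : 0 ≤ Real.log n / N := div_nonneg (Real.log_natCast_nonneg n) (Nat.cast_nonneg N)
  rw [Real.sq_sqrt hlog, ← mul_assoc, sqrt_mul_div_self]
  ring

theorem sqrt_le_of_le_mul_sqrt_log_div_sq_mul {N n : ℕ} (hN : 0 < N) {Q A C σ s : ℝ} (hA : 0 ≤ A)
    (hC : 0 ≤ C) (hσ : 0 ≤ σ) (hs : 0 ≤ s) (hQ : Q ≤ C * (A * (σ * √(Real.log n / N))) ^ 2 * s) :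
    √Q ≤ A * √(C * (s * Real.log n / √(N : ℝ))) * σ := by
  have := Real.log_natCast_nonneg n
  have hrs : √(Real.log n / N) ^ 2 * s ≤ s * Real.log n / √(N : ℝ) := by
    rw [← sqrt_mul_sqrt_log_div_sq_mul N n s]
    exact le_mul_of_one_le_left (by positivity) (Real.one_le_sqrt.2 (Nat.one_le_cast.2 hN))
  rw [Real.sqrt_le_left (by positivity), mul_pow, mul_pow, Real.sq_sqrt (by positivity)]
  calc Q ≤ C * A ^ 2 * σ ^ 2 * (√(Real.log n / N) ^ 2 * s) := by linarith
    _ ≤ C * A ^ 2 * σ ^ 2 * (s * Real.log n / √(N : ℝ)) := by gcongr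
    _ = A ^ 2 * (C * (s * Real.log n / √(N : ℝ))) * σ ^ 2 := by ring

theorem sqrt_mul_mul_le_of_le_mul_sqrt_log_div {N n : ℕ} {l mu A C C' σ s : ℝ} (hl0 : 0 ≤ l)
    (hC' : 0 ≤ C') (hl : l ≤ C * (A * (σ * √(Real.log n / N))) * s)
    (hmu : mu ≤ C' * √(Real.log n / N)) :
    √(N : ℝ) * (mu * l) ≤ C * C' * A * (s * Real.log n / √(N : ℝ)) * σ :=
  calc √(N : ℝ) * (mu * l)
      ≤ √(N : ℝ) * (C' * √(Real.log n / N) * (C * (A * (σ * √(Real.log n / N))) * s)) := by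
        gcongr
    _ = C * C' * A * (√(N : ℝ) * (√(Real.log n / N) ^ 2 * s)) * σ := by ring
    _ = C * C' * A * (s * Real.log n / √(N : ℝ)) * σ := by rw [sqrt_mul_sqrt_log_div_sq_mul]

theorem abs_sqrt_sub_one_le {x : ℝ} (hx : 0 ≤ x) : |√x - 1| ≤ |x - 1| := by
  have hfactor : x - 1 = (√x - 1) * (√x + 1) := by
    linear_combination -Real.mul_self_sqrt hx
  rw [hfactor, abs_mul, abs_of_nonneg (by positivity : 0 ≤ √x + 1)]
  exact le_mul_of_one_le_right (abs_nonneg _) (by linarith [Real.sqrt_nonneg x])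

variable {N n : ℕ} {X : Matrix (Fin N) (Fin n) ℝ} {S : Matrix (Fin n) (Fin n) ℝ}
  {ε : Fin N → ℝ} {σ : ℝ}

theorem abs_residualStd_div_sub_one_le {β b : Fin n → ℝ} {η p : ℝ} (hσ : 0 < σ)
    (hη : |1 / (N : ℝ) * ∑ i, (ε i / σ) ^ 2 - 1| ≤ η)
    (hp : √(1 / (N : ℝ) * ∑ i, (X *ᵥ (b - β)) i ^ 2) ≤ p * σ) :
    |residualStd X (response X β ε) b / σ - 1| ≤ p + η := by
  have hscale : √(1 / (N : ℝ) * ∑ i, ε i ^ 2) / σ = √(1 / (N : ℝ) * ∑ i, (ε i / σ) ^ 2) := by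
    simp only [div_pow, ← Finset.sum_div]
    rw [← mul_div_assoc, Real.sqrt_div' _ (sq_nonneg σ), Real.sqrt_sq hσ.le]
  have hnoise : |√(1 / (N : ℝ) * ∑ i, (ε i / σ) ^ 2) - 1| ≤ η :=
    (abs_sqrt_sub_one_le (by positivity)).trans hη
  have hfit : |residualStd X (response X β ε) b / σ - √(1 / (N : ℝ) * ∑ i, (ε i / σ) ^ 2)| ≤ p := by
    rw [← hscale, ← sub_div, abs_div, abs_of_pos hσ, div_le_iff₀ hσ]
    exact (abs_residualStd_sub_le β b ε).trans hp
  exact (abs_sub_le _ _ _).trans (add_le_add hfit hnoise)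

theorem abs_score_le {B x : ℝ} (hN : 0 < N) (hσ : 0 < σ) {a : Fin n} (hB : sampleCov X a a ≤ B)
    (h : |∑ i, unitWeight (fun i => X i a) i * (ε i / σ)| ≤ x * √(Real.log n)) :
    |1 / (N : ℝ) * ∑ i, X i a * ε i| ≤ √B * x * √(Real.log n / N) * σ := by
  have hN' : (0 : ℝ) < N := Nat.cast_pos.2 hN
  have hcol : l2 (fun i => X i a) = √(N : ℝ) * √(sampleCov X a a) := by
    rw [sampleCov_apply, ← Real.sqrt_mul hN'.le, l2]
    congr 1
    field_simp
  have hlog : 0 ≤ Real.log n := Real.log_natCast_nonneg n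
  rw [sum_mul_eq_l2_mul_sum_unitWeight _ _ hσ.ne', hcol, abs_mul, abs_mul,
    abs_of_nonneg (by positivity), abs_of_nonneg (by positivity)]
  calc 1 / (N : ℝ) * (√(N : ℝ) * √(sampleCov X a a) * σ
        * |∑ i, unitWeight (fun i => X i a) i * (ε i / σ)|)
      ≤ 1 / (N : ℝ) * (√(N : ℝ) * √B * σ * (x * √(Real.log n))) := by gcongr
    _ = √B * x * (√(N : ℝ) * (√(Real.log n) / N)) * σ := by ring
    _ = √B * x * √(Real.log n / N) * σ := by rw [sqrt_mul_div_self, Real.sqrt_div hlog]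

theorem exists_climeFeasible_of_dim_le {c D mu : ℝ}
    (hS : ∀ v : Fin n → ℝ, c * l2 v ^ 2 ≤ v ⬝ᵥ (S *ᵥ v))
    (hD : ∀ a b, |sampleCov X a b - S a b| ≤ D) (hD0 : 0 ≤ D) (hDn : D * n < c) (hmu : 0 ≤ mu) :
    ∃ Θ, ClimeFeasible X mu Θ := by
  have hpos : ∀ v ≠ 0, 0 < v ⬝ᵥ (sampleCov X *ᵥ v) := fun v hv => by
    have hl2 : 0 < l2 v := (l2_nonneg v).lt_of_ne' ((l2_eq_zero_iff v).not.2 hv)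
    have hl1 : D * l1 v ^ 2 ≤ D * (√n * l2 v) ^ 2 := by
      have := l1_nonneg v
      gcongr
      simpa using l1_le_sqrt_card_mul_l2 v
    rw [mul_pow, Real.sq_sqrt (by positivity)] at hl1
    have hgap : 0 < (c - D * n) * l2 v ^ 2 := mul_pos (sub_pos.2 hDn) (by positivity)
    linarith [le_dotProduct_sampleCov_mulVec hS hD v]
  have hu : IsUnit (sampleCov X).det := by
    rw [isUnit_iff_ne_zero]
    intro hdet
    obtain ⟨v, hv, hv0⟩ := exists_mulVec_eq_zero_iff.2 hdet
    simpa [hv0] using hpos v hv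
  refine ⟨(sampleCov X)⁻¹, fun a b => ?_⟩
  rw [nonsing_inv_mul _ hu, sub_self]
  simpa using hmu

/-- One instance of the linear model with its tuning parameters: the requirements on the quantities
that are not random. The factor in `le_lam` is the threshold for the constant in `λ`. -/
structure IsTunedModel (N : ℕ) (G : SimpleGraph (Fin n)) (k : ℕ) (ν c c' CLam CMu s₁ s₂ : ℝ)
    (β : Fin n → ℝ) (S : Matrix (Fin n) (Fin n) ℝ) (σ lam lamg mu : ℝ) : Prop where
  samples_pos : 0 < N
  two_le_dim : 2 ≤ n
  noise_pos : 0 < σ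
  lower_pos : 0 < c
  upper_pos : 0 < c'
  smooth_nonneg : 0 ≤ ν
  smooth_mul_le : ν * s₁ ≤ s₂
  mem_paramSpace : β ∈ paramSpace G k s₁ s₂
  isHermitian : S.IsHermitian
  spectrum_subset : spectrum ℝ S ⊆ Set.Icc c c'
  le_lam : 2 * (√(2 * c') * 2) * (σ * √(Real.log n / N)) ≤ lam
  lam_le : lam ≤ CLam * (σ * √(Real.log n / N))
  lamg_eq : lamg = lam * √(ν / (2 * maxDeg G) ^ (k + 1))
  mu_le : mu ≤ CMu * √(Real.log n / N)

/-- The good event: the sample points at which the sample covariance matrix, the scores and the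
noise variance are close to their expectations, the leading term is bounded and `Θ` satisfies the
CLIME constraint. -/
structure IsGoodSample (τ x η B mu σ : ℝ) (S Θ : Matrix (Fin n) (Fin n) ℝ)
    (X : Matrix (Fin N) (Fin n) ℝ) (ε : Fin N → ℝ) (j : Fin n) : Prop where
  abs_sampleCov_sub_le : ∀ a b, |sampleCov X a b - S a b| ≤ τ * √(Real.log n / N)
  abs_score_le : ∀ a, |∑ i, unitWeight (fun i => X i a) i * (ε i / σ)| ≤ x * √(Real.log n)
  abs_noise_variance_sub_one_le : |1 / (N : ℝ) * ∑ i, (ε i / σ) ^ 2 - 1| ≤ η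
  abs_leadingTerm_le : |leadingTerm X Θ j σ ε| ≤ B
  climeFeasible : ClimeFeasible X mu Θ

variable {G : SimpleGraph (Fin n)} {k : ℕ} {ν c c' CLam CMu s₁ s₂ s lam lamg mu τ x η A B κ : ℝ}
  {Θ : Matrix (Fin n) (Fin n) ℝ} {β b : Fin n → ℝ} {j : Fin n}

theorem IsGoodSample.sampleCov_apply_self_le (hg : IsGoodSample τ x η B mu σ S Θ X ε j)
    (hS : S.IsHermitian) (hspec : ∀ y ∈ spectrum ℝ S, y ≤ c') (hτ : τ * √(Real.log n / N) ≤ c')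
    (a : Fin n) : sampleCov X a a ≤ 2 * c' := by
  linarith [(abs_le.1 (hg.abs_sampleCov_sub_le a a)).2, apply_self_le_of_spectrum hS hspec a]

/-- The distance between the studentized statistic and its leading term on the good event, in terms
of `κ = s log n / √N`, the constant `A` in the rate of the estimator, the bound `B` on the leading
term and the error `η` of the noise variance. -/
noncomputable def remainder (c c' CMu A B η κ : ℝ) : ℝ :=
  2 * (B * (A * √(8 * κ / c) + η) + 24 * CMu * A * κ / (c * √(1 / (8 * c'))))

theorem tendsto_remainder {α : Type*} {l : Filter α} {κ : α → ℝ} (hκ : Tendsto κ l (𝓝 0)) :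
    Tendsto (fun t => remainder c c' CMu A B η (κ t)) l (𝓝 (2 * (B * η))) := by
  have hcont : Continuous fun κ => remainder c c' CMu A B η κ := by
    unfold remainder
    fun_prop
  have hlim := (hcont.tendsto 0).comp hκ
  have hzero : remainder c c' CMu A B η 0 = 2 * (B * η) := by simp [remainder]
  rwa [hzero] at hlim

namespace IsTunedModel

theorem log_dim_pos (hM : IsTunedModel N G k ν c c' CLam CMu s₁ s₂ β S σ lam lamg mu) :
    0 < Real.log n :=
  Real.log_pos (by exact_mod_cast hM.two_le_dim)

theorem sqrt_log_div_pos (hM : IsTunedModel N G k ν c c' CLam CMu s₁ s₂ β S σ lam lamg mu) :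
    0 < √(Real.log n / N) :=
  Real.sqrt_pos.2 (div_pos hM.log_dim_pos (Nat.cast_pos.2 hM.samples_pos))

theorem lam_pos (hM : IsTunedModel N G k ν c c' CLam CMu s₁ s₂ β S σ lam lamg mu) : 0 < lam := by
  have hc' := hM.upper_pos
  have hσ := hM.noise_pos
  have hr := hM.sqrt_log_div_pos
  exact lt_of_lt_of_le (by positivity) hM.le_lam

theorem lam_const_nonneg (hM : IsTunedModel N G k ν c c' CLam CMu s₁ s₂ β S σ lam lamg mu) :
    0 ≤ CLam :=
  nonneg_of_mul_nonneg_left (hM.lam_pos.le.trans hM.lam_le)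
    (mul_pos hM.noise_pos hM.sqrt_log_div_pos)

theorem sparsity_nonneg (hM : IsTunedModel N G k ν c c' CLam CMu s₁ s₂ β S σ lam lamg mu) :
    0 ≤ s₂ :=
  (Nat.cast_nonneg _).trans hM.mem_paramSpace.2

theorem lasso_rate (hM : IsTunedModel N G k ν c c' CLam CMu s₁ s₂ β S σ lam lamg mu)
    (hg : IsGoodSample τ x η B mu σ S Θ X ε j)
    (hb : objective G k lamg lam X (response X β ε) b
      ≤ objective G k lamg lam X (response X β ε) β)
    (hτ0 : 0 ≤ τ) (hx0 : 0 ≤ x) (hs : s₂ ≤ s) (hcase : x = 2 ∨ n ≤ s)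
    (hA : 6 * (√(2 * c') * x) + 3 * CLam ≤ A) (hτ : τ * √(Real.log n / N) ≤ c')
    (hτs : 36 * (τ * √(Real.log n / N)) * s ≤ c / 2) :
    l1 (b - β) ≤ 24 / c * (A * (σ * √(Real.log n / N))) * s ∧
      1 / (N : ℝ) * ∑ i, (X *ᵥ (b - β)) i ^ 2
        ≤ 8 / c * (A * (σ * √(Real.log n / N))) ^ 2 * s := by
  have hσ := hM.noise_pos
  have hc := hM.lower_pos
  have hr := hM.sqrt_log_div_pos
  have hlam := hM.lam_pos
  have hs0 : 0 ≤ s := hM.sparsity_nonneg.trans hs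
  have hdiag := hg.sampleCov_apply_self_le hM.isHermitian (fun x hx => (hM.spectrum_subset hx).2) hτ
  have hscore := fun a => abs_score_le hM.samples_pos hσ (hdiag a) (hg.abs_score_le a)
  have hpenalty : 2 * (√(2 * c') * x * √(Real.log n / N) * σ) ≤ lam ∨ (n : ℝ) ≤ s :=
    hcase.imp_left fun hx => by
      rw [hx]
      linarith [hM.le_lam]
  obtain ⟨hl1, hpred⟩ := lasso_error_bound hM.smooth_nonneg
    ((Nat.cast_nonneg _).trans hM.mem_paramSpace.1) hM.smooth_mul_le hs hlam hM.lamg_eq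
    hM.mem_paramSpace hb hc
    (mul_l2_sq_le_of_spectrum hM.isHermitian fun x hx => (hM.spectrum_subset hx).1)
    (by positivity) hg.abs_sampleCov_sub_le hτs (by positivity) hscore hpenalty
  have hrate : 6 * (√(2 * c') * x * √(Real.log n / N) * σ) + 3 * lam
      ≤ A * (σ * √(Real.log n / N)) :=
    calc _ ≤ (6 * (√(2 * c') * x) + 3 * CLam) * (σ * √(Real.log n / N)) := by
          linarith [hM.lam_le]
      _ ≤ A * (σ * √(Real.log n / N)) := by gcongr
  exact ⟨hl1.trans (by gcongr), hpred.trans (by gcongr)⟩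

theorem mu_const_nonneg
    (hM : IsTunedModel N G k ν c c' CLam CMu s₁ s₂ β S σ lam lamg mu)
    (hΘ : ClimeFeasible X mu Θ) (j : Fin n) : 0 ≤ CMu :=
  nonneg_of_mul_nonneg_left ((abs_nonneg _).trans ((hΘ j j).trans hM.mu_le)) hM.sqrt_log_div_pos

theorem abs_studentized_sub_leadingTerm_le
    (hM : IsTunedModel N G k ν c c' CLam CMu s₁ s₂ β S σ lam lamg mu)
    (hg : IsGoodSample τ x η B mu σ S Θ X ε j)
    (hb : objective G k lamg lam X (response X β ε) b
      ≤ objective G k lamg lam X (response X β ε) β)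
    (hτ0 : 0 ≤ τ) (hx0 : 0 ≤ x) (hs : s₂ ≤ s) (hcase : x = 2 ∨ n ≤ s)
    (hA : 6 * (√(2 * c') * x) + 3 * CLam ≤ A) (hκ : s * Real.log n / √(N : ℝ) = κ)
    (hτ : τ * √(Real.log n / N) ≤ c') (hτκ : 72 * τ * κ ≤ c / 2)
    (hmu : CMu * √(Real.log n / N) ≤ 1 / 2) (hsmall : A * √(8 * κ / c) + η ≤ 1 / 2) :
    |studentized X (response X β ε) Θ b β j - leadingTerm X Θ j σ ε|
      ≤ remainder c c' CMu A B η κ := by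
  have hσ := hM.noise_pos
  have hc := hM.lower_pos
  have hc' := hM.upper_pos
  have hs0 : 0 ≤ s := hM.sparsity_nonneg.trans hs
  have hA0 : 0 ≤ A := by
    have := hM.lam_const_nonneg
    exact (by positivity : (0 : ℝ) ≤ _).trans hA
  have hτs : 36 * (τ * √(Real.log n / N)) * s ≤ c / 2 :=
    calc 36 * (τ * √(Real.log n / N)) * s = 36 * τ * (√(Real.log n / N) * s) := by ring
      _ ≤ 36 * τ * (2 * κ) := by
        have := sqrt_log_div_mul_le (N := N) hM.two_le_dim hs0
        rw [hκ] at this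
        gcongr
      _ ≤ c / 2 := by linarith
  obtain ⟨hl1, hpred⟩ := hM.lasso_rate hg hb hτ0 hx0 hs hcase hA hτ hτs
  have hfit := sqrt_le_of_le_mul_sqrt_log_div_sq_mul hM.samples_pos hA0 (by positivity) hσ.le hs0
    hpred
  rw [hκ, div_mul_eq_mul_div (8 : ℝ)] at hfit
  have hbias := sqrt_mul_mul_le_of_le_mul_sqrt_log_div (l1_nonneg _)
    (hM.mu_const_nonneg hg.climeFeasible j) hl1 hM.mu_le
  have hcancel : 24 / c * CMu * A * κ * σ
      = 24 * CMu * A * κ / (c * √(1 / (8 * c'))) * (σ * √(1 / (8 * c'))) := by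
    field_simp
  rw [hκ, hcancel] at hbias
  have hdiag := hg.sampleCov_apply_self_le hM.isHermitian
    (fun x hx => (hM.spectrum_subset hx).2) hτ j
  have hvar := hg.climeFeasible.variance_lower_bound (hM.mu_le.trans hmu) hdiag (by positivity)
  exact GraphLasso.abs_studentized_sub_leadingTerm_le hσ (by positivity) hg.climeFeasible
    (le_of_eq_of_le (by ring) hvar) hg.abs_leadingTerm_le
    (abs_residualStd_div_sub_one_le hσ hg.abs_noise_variance_sub_one_le hfit) hsmall hbias

end IsTunedModel

end GoodSample

section GoodEvent

theorem measureReal_mono_ae {Ω : Type*} [MeasurableSpace Ω] {P : Measure Ω} [IsFiniteMeasure P]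
    {p q : Ω → Prop} (h : ∀ᵐ ω ∂P, p ω → q ω) : P.real {ω | p ω} ≤ P.real {ω | q ω} :=
  ENNReal.toReal_mono (measure_ne_top P _) (measure_mono_ae h)

variable {Ω : Type*} [MeasurableSpace Ω] {P : Measure Ω} [IsProbabilityMeasure P] {N n : ℕ}
  {σx σ : ℝ} {S : Matrix (Fin n) (Fin n) ℝ} {X : Ω → Fin N → Fin n → ℝ} {ε : Ω → Fin N → ℝ}

theorem hasLaw_score (hN : 0 < N) (hσ : 0 < σ) (hX : Measurable X) (hε : IsGaussianNoise σ ε P)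
    (hind : IndepFun X ε P) (a : Fin n) :
    HasLaw (fun ω => ∑ i, unitWeight (fun i => Matrix.of (X ω) i a) i * (ε ω i / σ))
      (gaussianReal 0 1) P :=
  hε.hasLaw_sum_of_indepFun hσ hX.aemeasurable hind
    (w := fun x i => unitWeight (fun i => Matrix.of x i a) i)
    (measurable_pi_iff.2 fun i => (measurable_unitWeight i).comp
      (measurable_pi_iff.2 fun i => (measurable_pi_apply a).comp (measurable_pi_apply i)))
    fun _ => sum_unitWeight_sq hN _

theorem hasLaw_leadingTerm (hN : 0 < N) (hσ : 0 < σ) (hX : Measurable X)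
    (hε : IsGaussianNoise σ ε P) (hind : IndepFun X ε P)
    {Θ : (Fin N → Fin n → ℝ) → Matrix (Fin n) (Fin n) ℝ}
    (hΘ : ∀ a b, Measurable fun x => Θ x a b) (j : Fin n) :
    HasLaw (fun ω => leadingTerm (Matrix.of (X ω)) (Θ (X ω)) j σ (ε ω)) (gaussianReal 0 1) P := by
  refine hε.hasLaw_sum_of_indepFun hσ hX.aemeasurable hind
    (w := fun x i => unitWeight (fun i => (Matrix.of x * (Θ x)ᵀ) i j) i)
    (measurable_pi_iff.2 fun i => (measurable_unitWeight i).comp (measurable_pi_iff.2 fun i => ?_))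
    fun _ => sum_unitWeight_sq hN _
  change Measurable fun x : Fin N → Fin n → ℝ => ∑ a, x i a * Θ x j a
  fun_prop

/-- The constant in the deviation of the CLIME constraint at `S⁻¹` for sub-Gaussian parameter
`c`. -/
noncomputable def climeConst (c : NNReal) : ℝ := √(3 * (512 * √2 * c ^ 2))

theorem measureReal_not_climeFeasible_inv_le (hX : IsSubGaussianDesign σx S X P) (hN : 0 < N)
    (hn : 0 < n) {κ : ℝ} (hκ : 0 < κ) (hspec : ∀ x ∈ spectrum ℝ S, κ ≤ x) {c : NNReal}
    (hc : 0 < c) (hσc : σx ^ 2 ≤ c) (hσκ : σx ^ 2 * (1 / κ) ^ 2 ≤ c) {mu : ℝ}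
    (hmu : climeConst c * √(Real.log n / N) ≤ mu)
    (hr : climeConst c * √(Real.log n / N) ≤ 32 * √2 * c) :
    P.real {ω | ¬ ClimeFeasible (Matrix.of (X ω)) mu S⁻¹} ≤ 2 * Real.exp (-Real.log n) := by
  have hdev := hX.measureReal_exists_abs_inv_mul_sampleCov_sub_one_ge_le hN hn hκ hspec hc hσc hσκ
    (τ := climeConst c) (q := 1) (Real.sqrt_nonneg _)
    (by rw [climeConst, Real.sq_sqrt (by positivity)]; linarith) hr
  rw [one_mul] at hdev
  refine (measureReal_mono fun ω hω => ?_).trans hdev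
  simp only [ClimeFeasible, not_forall, not_le, Set.mem_ofPred_eq] at hω
  obtain ⟨a, b, hab⟩ := hω
  exact ⟨a, b, hmu.trans hab.le⟩

theorem measureReal_not_climeFeasible_le_of_dim_le {κ τ mu : ℝ}
    {Θ : Ω → Matrix (Fin n) (Fin n) ℝ} (hS : S.IsHermitian)
    (hspec : ∀ x ∈ spectrum ℝ S, κ ≤ x)
    (hΘ : ∀ᵐ ω ∂P, (∃ Θ', ClimeFeasible (Matrix.of (X ω)) mu Θ') →
      ClimeFeasible (Matrix.of (X ω)) mu (Θ ω))
    (hτ : 0 ≤ τ) (hmu : 0 ≤ mu) (hτn : τ * √(Real.log n / N) * n < κ) :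
    P.real {ω | ¬ ClimeFeasible (Matrix.of (X ω)) mu (Θ ω)}
      ≤ P.real {ω | ∃ a b,
          τ * √(Real.log n / N) ≤ |sampleCov (Matrix.of (X ω)) a b - S a b|} := by
  refine measureReal_mono_ae ?_
  filter_upwards [hΘ] with ω hω hinfeasible
  by_contra! hcov
  exact hinfeasible (hω (exists_climeFeasible_of_dim_le (mul_l2_sq_le_of_spectrum hS hspec)
    (fun a b => (hcov a b).le) (by positivity) hτn hmu))

theorem measureReal_not_isGoodSample_le {τ x η B mu δ : ℝ} {Θ : Ω → Matrix (Fin n) (Fin n) ℝ}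
    {j : Fin n}
    (hcov : P.real {ω | ∃ a b,
      τ * √(Real.log n / N) ≤ |sampleCov (Matrix.of (X ω)) a b - S a b|} ≤ δ)
    (hscore : P.real {ω | ∃ a, x * √(Real.log n)
      ≤ |∑ i, unitWeight (fun i => Matrix.of (X ω) i a) i * (ε ω i / σ)|} ≤ δ)
    (hnoise : P.real {ω | η ≤ |1 / (N : ℝ) * ∑ i, (ε ω i / σ) ^ 2 - 1|} ≤ δ)
    (hlead : P.real {ω | B ≤ |leadingTerm (Matrix.of (X ω)) (Θ ω) j σ (ε ω)|} ≤ δ)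
    (hclime : P.real {ω | ¬ ClimeFeasible (Matrix.of (X ω)) mu (Θ ω)} ≤ δ) :
    P.real {ω | ¬ IsGoodSample τ x η B mu σ S (Θ ω) (Matrix.of (X ω)) (ε ω) j} ≤ 5 * δ := by
  set E₁ := {ω | ∃ a b, τ * √(Real.log n / N) ≤ |sampleCov (Matrix.of (X ω)) a b - S a b|}
  set E₂ := {ω | ∃ a, x * √(Real.log n)
    ≤ |∑ i, unitWeight (fun i => Matrix.of (X ω) i a) i * (ε ω i / σ)|}
  set E₃ := {ω | η ≤ |1 / (N : ℝ) * ∑ i, (ε ω i / σ) ^ 2 - 1|}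
  set E₄ := {ω | B ≤ |leadingTerm (Matrix.of (X ω)) (Θ ω) j σ (ε ω)|}
  set E₅ := {ω | ¬ ClimeFeasible (Matrix.of (X ω)) mu (Θ ω)}
  have hsub : {ω | ¬ IsGoodSample τ x η B mu σ S (Θ ω) (Matrix.of (X ω)) (ε ω) j}
      ⊆ E₁ ∪ E₂ ∪ E₃ ∪ E₄ ∪ E₅ := by
    intro ω hω
    contrapose! hω
    simp only [E₁, E₂, E₃, E₄, E₅, Set.mem_union, Set.mem_ofPred_eq, not_or, not_exists, not_le,
      not_not] at hω ⊢
    obtain ⟨⟨⟨⟨h₁, h₂⟩, h₃⟩, h₄⟩, h₅⟩ := hω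
    exact ⟨fun a b => (h₁ a b).le, fun a => (h₂ a).le, h₃.le, h₄.le, h₅⟩
  linarith [measureReal_mono hsub (μ := P), measureReal_union_le (μ := P) (E₁ ∪ E₂ ∪ E₃ ∪ E₄) E₅,
    measureReal_union_le (μ := P) (E₁ ∪ E₂ ∪ E₃) E₄, measureReal_union_le (μ := P) (E₁ ∪ E₂) E₃,
    measureReal_union_le (μ := P) E₁ E₂]

end GoodEvent

section Levels

/-- The constant in the deviation of the sample covariance matrix that is exceeded with probability
at most `2 exp (-q)`, for sub-Gaussian parameter `c`. -/
noncomputable def covLevel (c : NNReal) (q : ℝ) : ℝ := √((2 + 2 * q) * (512 * √2 * c ^ 2))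

/-- The constant in the bound on the scores in dimension `n` that is exceeded with probability at
most `2 exp (-q)`. It is `2`, which does not depend on `q`, in large dimensions. -/
noncomputable def scoreLevel (n : ℕ) (q : ℝ) : ℝ :=
  if Real.log n ≤ q then max 2 √(2 * (1 + 2 * q)) else 2

/-- The sparsity level that exceeds the dimension whenever `scoreLevel` is not `2`. -/
noncomputable def adjustedSparsity (n : ℕ) (q s : ℝ) : ℝ :=
  s + if Real.log n ≤ q then (n : ℝ) else 0

theorem scoreLevel_nonneg (n : ℕ) (q : ℝ) : 0 ≤ scoreLevel n q := by
  unfold scoreLevel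
  split_ifs <;> positivity

theorem scoreLevel_le (n : ℕ) (q : ℝ) : scoreLevel n q ≤ max 2 √(2 * (1 + 2 * q)) := by
  unfold scoreLevel
  split_ifs
  exacts [le_rfl, le_max_left _ _]

theorem le_adjustedSparsity (n : ℕ) (q s : ℝ) : s ≤ adjustedSparsity n q s := by
  unfold adjustedSparsity
  split_ifs
  exacts [le_add_of_nonneg_right n.cast_nonneg, (add_zero s).ge]

theorem scoreLevel_eq_two_or_le_adjustedSparsity (n : ℕ) (q : ℝ) {s : ℝ} (hs : 0 ≤ s) :
    scoreLevel n q = 2 ∨ n ≤ adjustedSparsity n q s := by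
  by_cases h : Real.log n ≤ q
  · exact .inr (by simpa [adjustedSparsity, h])
  · exact .inl (if_neg h)

theorem tendsto_adjustedSparsity {N n : ℕ → ℕ} {s : ℕ → ℝ} (hn : ∀ t, 0 < n t)
    (hN : Tendsto N atTop atTop)
    (hs : Tendsto (fun t => s t * Real.log (n t) / √(N t : ℝ)) atTop (𝓝 0)) (q : ℝ) :
    Tendsto (fun t => adjustedSparsity (n t) q (s t) * Real.log (n t) / √(N t : ℝ))
      atTop (𝓝 0) := by
  have hsqrt : Tendsto (fun t => √(N t : ℝ)) atTop atTop :=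
    Real.tendsto_sqrt_atTop.comp (tendsto_natCast_atTop_atTop.comp hN)
  have hconst : Tendsto (fun t => Real.exp q * |q| / √(N t : ℝ)) atTop (𝓝 0) :=
    hsqrt.const_div_atTop _
  have hextra : Tendsto (fun t => (if Real.log (n t) ≤ q then (n t : ℝ) else 0)
      * Real.log (n t) / √(N t : ℝ)) atTop (𝓝 0) := by
    refine squeeze_zero (fun t => ?_) (fun t => ?_) hconst
    · have := Real.log_natCast_nonneg (n t)
      split_ifs <;> positivity
    · split_ifs with h
      · have hexp : (n t : ℝ) ≤ Real.exp q := (Real.log_le_iff_le_exp (mod_cast hn t)).1 h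
        have := Real.log_natCast_nonneg (n t)
        have habs := h.trans (le_abs_self q)
        gcongr
      · rw [zero_mul, zero_div]
        positivity
  simpa only [adjustedSparsity, add_mul, add_div, add_zero] using hs.add hextra

end Levels

section GoodSampleProbability

variable {Ω : Type*} [MeasurableSpace Ω] {P : Measure Ω} [IsProbabilityMeasure P] {N n k : ℕ}
  {G : SimpleGraph (Fin n)} {σx σ ν cmin cmax CLam CMu s₁ s₂ lam lamg mu : ℝ} {β : Fin n → ℝ}
  {S : Matrix (Fin n) (Fin n) ℝ} {X : Ω → Fin N → Fin n → ℝ} {ε : Ω → Fin N → ℝ}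
  {Θ : (Fin N → Fin n → ℝ) → Matrix (Fin n) (Fin n) ℝ} {c : NNReal} {q η : ℝ}

theorem le_two_mul_mul_log (hn : 2 ≤ n) (hq : 0 ≤ q) : q ≤ 2 * q * Real.log n := by
  have hlog : 1 / 2 ≤ Real.log n := by
    linarith [Real.log_two_gt_d9, Real.log_le_log two_pos (Nat.cast_le (α := ℝ).2 hn)]
  linarith [mul_le_mul_of_nonneg_left hlog hq]

theorem measureReal_exists_scoreLevel_le {Z : Fin n → Ω → ℝ} (hn : 2 ≤ n)
    (hZ : ∀ a, HasLaw (Z a) (gaussianReal 0 1) P) (hq : 0 ≤ q) :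
    P.real {ω | ∃ a, scoreLevel n q * √(Real.log n) ≤ |Z a ω|} ≤ 2 * Real.exp (-q) := by
  by_cases h : Real.log n ≤ q
  · have hsq : 2 * (1 + 2 * q) ≤ scoreLevel n q ^ 2 := by
      rw [scoreLevel, if_pos h, ← Real.sqrt_le_left (by positivity)]
      exact le_max_right _ _
    refine (measureReal_exists_abs_ge_le_of_hasLaw (by lia) hZ (scoreLevel_nonneg n q) hsq).trans ?_
    gcongr
    exact le_two_mul_mul_log hn hq
  · have hsq : 2 * (1 + 1) ≤ scoreLevel n q ^ 2 := by
      rw [scoreLevel, if_neg h]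
      norm_num
    refine (measureReal_exists_abs_ge_le_of_hasLaw (by lia) hZ (scoreLevel_nonneg n q) hsq).trans ?_
    gcongr
    linarith

theorem IsTunedModel.measureReal_not_isGoodSample_le
    (hM : IsTunedModel N G k ν cmin cmax CLam CMu s₁ s₂ β S σ lam lamg mu)
    (hX : IsSubGaussianDesign σx S X P) (hε : IsGaussianNoise σ ε P) (hind : IndepFun X ε P)
    (hc : 0 < c) (hσc : σx ^ 2 ≤ c) (hσκ : σx ^ 2 * (1 / cmin) ^ 2 ≤ c)
    (hmu : climeConst c * √(Real.log n / N) ≤ mu)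
    (hΘm : ∀ a b, Measurable fun x => Θ x a b)
    (hΘ : ∀ᵐ ω ∂P, (∃ Θ', ClimeFeasible (Matrix.of (X ω)) mu Θ') →
      ClimeFeasible (Matrix.of (X ω)) mu (Θ (X ω)))
    (hq : 0 ≤ q) (hη : 0 ≤ η) (hη' : η ≤ 32 * √2) (hqη : q ≤ N * η ^ 2 / (512 * √2))
    (hcov : covLevel c q * √(Real.log n / N) ≤ 32 * √2 * c)
    (hclime : climeConst c * √(Real.log n / N) ≤ 32 * √2 * c)
    (hlow : covLevel c q * √(Real.log n / N) * Real.exp q < cmin) (j : Fin n) :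
    P.real {ω | ¬ IsGoodSample (covLevel c q) (scoreLevel n q) η √(2 * q) mu σ S (Θ (X ω))
      (Matrix.of (X ω)) (ε ω) j} ≤ 5 * (2 * Real.exp (-q)) := by
  have hN := hM.samples_pos
  have hn : 0 < n := by have := hM.two_le_dim; lia
  have hσ := hM.noise_pos
  have hspec := fun x hx => (hM.spectrum_subset hx : x ∈ Set.Icc cmin cmax).1
  have hdev : P.real {ω | ∃ a b, covLevel c q * √(Real.log n / N)
      ≤ |sampleCov (Matrix.of (X ω)) a b - S a b|} ≤ 2 * Real.exp (-q) := by
    refine (hX.measureReal_exists_abs_sampleCov_sub_ge_le hN hn hc hσc (q := 2 * q)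
      (Real.sqrt_nonneg _) (Real.sq_sqrt (by positivity)).ge hcov).trans ?_
    gcongr
    exact le_two_mul_mul_log hM.two_le_dim hq
  refine GraphLasso.measureReal_not_isGoodSample_le hdev
    (measureReal_exists_scoreLevel_le hM.two_le_dim
      (hasLaw_score hN hσ hX.measurable hε hind) hq) ?_ ?_ ?_
  · refine (hε.measureReal_abs_average_sq_sub_one_ge_le hσ hN hη hη').trans ?_
    gcongr
  · refine (measureReal_abs_ge_le_of_hasLaw
      (hasLaw_leadingTerm hN hσ hX.measurable hε hind hΘm j) (Real.sqrt_nonneg _)).trans_eq ?_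
    rw [Real.sq_sqrt (by positivity), mul_div_cancel_left₀ q two_ne_zero]
  · rcases le_or_gt (Real.log n) q with h | h
    · have hexp : (n : ℝ) ≤ Real.exp q := (Real.log_le_iff_le_exp (mod_cast hn)).1 h
      refine (measureReal_not_climeFeasible_le_of_dim_le hM.isHermitian hspec hΘ
        (Real.sqrt_nonneg _) (le_trans (by unfold climeConst; positivity) hmu) ?_).trans hdev
      refine lt_of_le_of_lt ?_ hlow
      unfold covLevel
      gcongr
    · have hinv := measureReal_not_climeFeasible_inv_le hX hN hn hM.lower_pos hspec hc hσc hσκ hmu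
        hclime
      refine ((measureReal_mono_ae ?_).trans hinv).trans (by gcongr)
      filter_upwards [hΘ] with ω hω hinfeasible hfeasible
      exact hinfeasible (hω ⟨_, hfeasible⟩)

end GoodSampleProbability

section Rates

/-- The constant `A` in the rate of the estimator at the score levels of all dimensions. -/
noncomputable def rateConst (cmax CLam q : ℝ) : ℝ :=
  6 * (√(2 * cmax) * max 2 √(2 * (1 + 2 * q))) + 3 * CLam

/-- The smallness conditions on `r = √(log n / N)` and `κ = s log n / √N`, for a sample of size `m`,
under which the studentized statistic is within `e` of its leading term except with probability
`10 exp (-q)`. -/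
structure IsSmallRate (cmin cmax CLam CMu : ℝ) (c : NNReal) (q η e m r κ : ℝ) : Prop where
  covLevel_mul_le : covLevel c q * r ≤ 32 * √2 * c
  covLevel_mul_le_upper : covLevel c q * r ≤ cmax
  covLevel_mul_mul_exp_lt : covLevel c q * r * Real.exp q < cmin
  climeConst_mul_le : climeConst c * r ≤ 32 * √2 * c
  mu_const_mul_le : CMu * r ≤ 1 / 2
  covLevel_mul_sparsity_le : 72 * covLevel c q * κ ≤ cmin / 2
  fit_le : rateConst cmax CLam q * √(8 * κ / cmin) + η ≤ 1 / 2
  remainder_lt : remainder cmin cmax CMu (rateConst cmax CLam q) √(2 * q) η κ < e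
  le_samples : q ≤ m * η ^ 2 / (512 * √2)

theorem eventually_isSmallRate {α : Type*} {l : Filter α} {cmin cmax : ℝ} (CLam CMu : ℝ)
    (hcmin : 0 < cmin) (hcmax : 0 < cmax) {c : NNReal} (hc : 0 < c) {q η e : ℝ} (hη : 0 < η)
    (hη' : η < 1 / 2) (he : 2 * (√(2 * q) * η) < e) {m r κ : α → ℝ} (hm : Tendsto m l atTop)
    (hr : Tendsto r l (𝓝 0)) (hκ : Tendsto κ l (𝓝 0)) :
    ∀ᶠ t in l, IsSmallRate cmin cmax CLam CMu c q η e (m t) (r t) (κ t) := by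
  have hsmall : ∀ {f : α → ℝ} (_ : Tendsto f l (𝓝 0)) (a : ℝ) {b : ℝ} (_ : 0 < b),
      ∀ᶠ t in l, a * f t < b := fun hf a b hb =>
    (mul_zero a ▸ hf.const_mul a).eventually_lt_const hb
  have hfit : ∀ᶠ t in l, rateConst cmax CLam q * √(8 * κ t / cmin) + η < 1 / 2 := by
    have hcont : Continuous fun κ => rateConst cmax CLam q * √(8 * κ / cmin) + η := by fun_prop
    have hlim := (hcont.tendsto 0).comp hκ
    rw [mul_zero, zero_div, Real.sqrt_zero, mul_zero, zero_add] at hlim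
    exact hlim.eventually_lt_const hη'
  have hc32 : 0 < 32 * √2 * (c : ℝ) := by positivity
  filter_upwards [hsmall hr (covLevel c q) hc32, hsmall hr (covLevel c q) hcmax,
    hsmall hr (covLevel c q) (div_pos hcmin (Real.exp_pos q)), hsmall hr (climeConst c) hc32,
    hsmall hr CMu one_half_pos, hsmall hκ (72 * covLevel c q) (half_pos hcmin), hfit,
    (tendsto_remainder hκ).eventually_lt_const he,
    hm.eventually_ge_atTop (q * (512 * √2) / η ^ 2)] with t h₁ h₂ h₃ h₄ h₅ h₆ h₇ h₈ h₉
  refine ⟨h₁.le, h₂.le, (lt_div_iff₀ (Real.exp_pos q)).1 h₃, h₄.le, h₅.le, h₆.le, h₇.le, h₈, ?_⟩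
  rwa [le_div_iff₀ (by positivity), ← div_le_iff₀ (by positivity)]

end Rates

section Linearization

theorem IsTunedModel.measureReal_abs_studentized_sub_leadingTerm_ge_le {Ω : Type*}
    [MeasurableSpace Ω] {P : Measure Ω} [IsProbabilityMeasure P] {N n k : ℕ}
    {G : SimpleGraph (Fin n)} {σx σ ν cmin cmax CLam CMu s₁ s₂ lam lamg mu : ℝ} {β : Fin n → ℝ}
    {S : Matrix (Fin n) (Fin n) ℝ} {X : Ω → Fin N → Fin n → ℝ} {ε : Ω → Fin N → ℝ}
    {Θ : (Fin N → Fin n → ℝ) → Matrix (Fin n) (Fin n) ℝ} {b : Ω → Fin n → ℝ} {c : NNReal}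
    {q η e : ℝ}
    (hM : IsTunedModel N G k ν cmin cmax CLam CMu s₁ s₂ β S σ lam lamg mu)
    (hX : IsSubGaussianDesign σx S X P) (hε : IsGaussianNoise σ ε P) (hind : IndepFun X ε P)
    (hc : 0 < c) (hσc : σx ^ 2 ≤ c) (hσκ : σx ^ 2 * (1 / cmin) ^ 2 ≤ c)
    (hmu : climeConst c * √(Real.log n / N) ≤ mu)
    (hΘm : ∀ a b, Measurable fun x => Θ x a b)
    (hΘ : ∀ᵐ ω ∂P, (∃ Θ', ClimeFeasible (Matrix.of (X ω)) mu Θ') →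
      ClimeFeasible (Matrix.of (X ω)) mu (Θ (X ω)))
    (hb : ∀ᵐ ω ∂P, objective G k lamg lam (Matrix.of (X ω)) (response (Matrix.of (X ω)) β (ε ω))
      (b ω) ≤ objective G k lamg lam (Matrix.of (X ω)) (response (Matrix.of (X ω)) β (ε ω)) β)
    (hq : 0 ≤ q) (hη : 0 ≤ η) (hη' : η ≤ 32 * √2)
    (hrate : IsSmallRate cmin cmax CLam CMu c q η e N √(Real.log n / N)
      (adjustedSparsity n q s₂ * Real.log n / √(N : ℝ))) (j : Fin n) :
    P.real {ω | e ≤ |studentized (Matrix.of (X ω)) (response (Matrix.of (X ω)) β (ε ω))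
        (Θ (X ω)) (b ω) β j - leadingTerm (Matrix.of (X ω)) (Θ (X ω)) j σ (ε ω)|}
      ≤ 5 * (2 * Real.exp (-q)) := by
  refine (measureReal_mono_ae ?_).trans (hM.measureReal_not_isGoodSample_le hX hε hind hc hσc hσκ
    hmu hΘm hΘ hq hη hη' hrate.le_samples hrate.covLevel_mul_le hrate.climeConst_mul_le
    hrate.covLevel_mul_mul_exp_lt j)
  filter_upwards [hb] with ω hω hfar hgood
  have hA : 6 * (√(2 * cmax) * scoreLevel n q) + 3 * CLam ≤ rateConst cmax CLam q := by
    unfold rateConst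
    gcongr
    exact scoreLevel_le n q
  have hclose := hM.abs_studentized_sub_leadingTerm_le hgood hω (Real.sqrt_nonneg _)
    (scoreLevel_nonneg n q) (le_adjustedSparsity n q s₂)
    (scoreLevel_eq_two_or_le_adjustedSparsity n q hM.sparsity_nonneg) hA rfl
    hrate.covLevel_mul_le_upper hrate.covLevel_mul_sparsity_le hrate.mu_const_mul_le hrate.fit_le
  exact (hclose.trans_lt hrate.remainder_lt).not_ge hfar

theorem exists_nonneg_mul_exp_neg_le {δ : ℝ} (hδ : 0 < δ) :
    ∃ q ≥ 0, 5 * (2 * Real.exp (-q)) ≤ δ := by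
  have hlim := (Real.tendsto_exp_neg_atTop_nhds_zero.const_mul 2).const_mul 5
  rw [mul_zero, mul_zero] at hlim
  exact ((eventually_ge_atTop 0).and (hlim.eventually_le_const hδ)).exists

theorem exists_pos_lt_mul_lt {a d e : ℝ} (hd : 0 < d) (he : 0 < e) :
    ∃ η > 0, η < d ∧ 2 * (a * η) < e := by
  have hcont : Continuous fun η : ℝ => 2 * (a * η) := by fun_prop
  have hlim := (hcont.tendsto 0).mono_left (nhdsWithin_le_nhds (s := Set.Ioi 0))
  rw [mul_zero, mul_zero] at hlim
  obtain ⟨η, hη, hlt⟩ :=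
    ((Filter.eventually_of_mem (Ioo_mem_nhdsGT hd) fun _ h => h).and
      (hlim.eventually_lt_const he)).exists
  exact ⟨η, hη.1, hη.2, hlt⟩

end Linearization

section Sequence

theorem exists_pos_sq_le (σ κ : ℝ) :
    ∃ c : NNReal, 0 < c ∧ σ ^ 2 ≤ c ∧ σ ^ 2 * (1 / κ) ^ 2 ≤ c := by
  refine ⟨Real.toNNReal (σ ^ 2 + σ ^ 2 * (1 / κ) ^ 2 + 1), Real.toNNReal_pos.2 (by positivity), ?_⟩
  have hσ := sq_nonneg σ
  have hσκ : 0 ≤ σ ^ 2 * (1 / κ) ^ 2 := by positivity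
  rw [Real.coe_toNNReal _ (by positivity)]
  constructor <;> linarith

theorem climeConst_pos {c : NNReal} (hc : 0 < c) : 0 < climeConst c := by
  unfold climeConst
  positivity

theorem aemeasurable_studentized_response {Ω : Type*} [MeasurableSpace Ω] {P : Measure Ω} {N n : ℕ}
    {X : Ω → Fin N → Fin n → ℝ} {ε : Ω → Fin N → ℝ} {b : Ω → Fin n → ℝ}
    {Θ : (Fin N → Fin n → ℝ) → Matrix (Fin n) (Fin n) ℝ} (hX : Measurable X)
    (hε : AEMeasurable ε P) (hΘ : ∀ a b, Measurable fun x => Θ x a b) (hb : AEMeasurable b P)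
    (β : Fin n → ℝ) (j : Fin n) :
    AEMeasurable (fun ω => studentized (Matrix.of (X ω)) (response (Matrix.of (X ω)) β (ε ω))
      (Θ (X ω)) (b ω) β j) P := by
  have hXm : ∀ i a, AEMeasurable (fun ω => Matrix.of (X ω) i a) P := fun i a =>
    (measurable_pi_iff.1 (measurable_pi_iff.1 hX i) a).aemeasurable
  have hy : ∀ i, AEMeasurable (fun ω => response (Matrix.of (X ω)) β (ε ω) i) P := fun i =>
    (aemeasurable_mulVec (v := fun _ => β) hXm (fun _ => aemeasurable_const) i).add
      (aemeasurable_pi_iff.1 hε i)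
  have hΘX : ∀ a c, AEMeasurable (fun ω => Θ (X ω) a c) P := fun a c =>
    ((hΘ a c).comp hX).aemeasurable
  exact aemeasurable_studentized hXm hy hΘX (aemeasurable_pi_iff.1 hb) β j

theorem aemeasurable_leadingTerm {Ω : Type*} [MeasurableSpace Ω] {P : Measure Ω}
    [IsProbabilityMeasure P] {N n : ℕ} {σ : ℝ} {X : Ω → Fin N → Fin n → ℝ} {ε : Ω → Fin N → ℝ}
    {Θ : (Fin N → Fin n → ℝ) → Matrix (Fin n) (Fin n) ℝ} (hσ : 0 < σ) (hX : Measurable X)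
    (hε : IsGaussianNoise σ ε P) (hind : IndepFun X ε P) (hΘ : ∀ a b, Measurable fun x => Θ x a b)
    (j : Fin n) :
    AEMeasurable (fun ω => leadingTerm (Matrix.of (X ω)) (Θ (X ω)) j σ (ε ω)) P := by
  rcases N.eq_zero_or_pos with rfl | hN
  · simp [leadingTerm]
  · exact (hasLaw_leadingTerm hN hσ hX hε hind hΘ j).aemeasurable

theorem tendsto_sqrt_log_div_of_sum_abs_inv_le {α : Type*} {l : Filter α} {N n : α → ℕ}
    {S : ∀ t, Matrix (Fin (n t)) (Fin (n t)) ℝ} {M : α → ℝ} {cmin cmax : ℝ} (hcmin : 0 < cmin)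
    (hcmax : 0 < cmax) (hS : ∀ᶠ t in l, (S t).IsHermitian)
    (hspec : ∀ t, spectrum ℝ (S t) ⊆ Set.Icc cmin cmax)
    (hrow : ∀ t a, ∑ b, |(S t)⁻¹ a b| ≤ M t) (j : ∀ t, Fin (n t))
    (hM : Tendsto (fun t => M t * √(Real.log (n t) / N t)) l (𝓝 0)) :
    Tendsto (fun t => √(Real.log (n t) / N t)) l (𝓝 0) := by
  have hlim := hM.const_mul cmax
  rw [mul_zero] at hlim
  refine squeeze_zero' (.of_forall fun t => Real.sqrt_nonneg _) ?_ hlim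
  filter_upwards [hS] with t ht
  have hrow' : 1 / cmax ≤ M t :=
    calc 1 / cmax ≤ (S t)⁻¹ (j t) (j t) := one_div_le_inv_apply_self ht hcmax
          (fun x hx => hcmin.trans_le (hspec t hx).1) (fun x hx => (hspec t hx).2) (j t)
      _ ≤ |(S t)⁻¹ (j t) (j t)| := le_abs_self _
      _ ≤ ∑ b, |(S t)⁻¹ (j t) b| :=
        Finset.single_le_sum (f := fun b => |(S t)⁻¹ (j t) b|) (fun b _ => abs_nonneg _)
          (Finset.mem_univ (j t))
      _ ≤ M t := hrow t (j t)
  rw [← mul_assoc]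
  exact le_mul_of_one_le_left (Real.sqrt_nonneg _) ((div_le_iff₀' hcmax).1 hrow')

end Sequence

end GraphLasso

theorem corollary3_general (σx cmin cmax : ℝ) (hcmin : 0 < cmin) (hcmax : 0 < cmax) :
    ∃ cLam > (0 : ℝ), ∃ cMu > (0 : ℝ), ∀ (CLam CMu : ℝ) (k : ℕ) (ν : ℝ) (_ : 0 ≤ ν)
      (N n : ℕ → ℕ) (_ : Tendsto N atTop atTop) (_ : ∀ t, 2 ≤ n t)
      (G : ∀ t, SimpleGraph (Fin (n t))) (s₁ s₂ : ℕ → ℝ) (_ : ∀ t, ν * s₁ t ≤ s₂ t)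
      (β : ∀ t, Fin (n t) → ℝ) (_ : ∀ t, β t ∈ paramSpace (G t) k (s₁ t) (s₂ t))
      (Ω : ℕ → Type*) [∀ t, MeasurableSpace (Ω t)] (P : ∀ t, Measure (Ω t))
      [∀ t, IsProbabilityMeasure (P t)]
      (X : ∀ t, Ω t → Fin (N t) → Fin (n t) → ℝ) (ε : ∀ t, Ω t → Fin (N t) → ℝ)
      (Sx : ∀ t, Matrix (Fin (n t)) (Fin (n t)) ℝ) (σε : ℕ → ℝ) (_ : ∀ t, 0 < σε t)
      (_ : ∀ t, IsSubGaussianDesign σx (Sx t) (X t) (P t))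
      (_ : ∀ t, spectrum ℝ (Sx t) ⊆ Set.Icc cmin cmax)
      (_ : ∀ t, IsGaussianNoise (σε t) (ε t) (P t))
      (_ : ∀ t, IndepFun (X t) (ε t) (P t))
      (lam lamg mu : ℕ → ℝ)
      (_ : ∀ t, cLam * (σε t * √(Real.log (n t) / N t)) ≤ lam t)
      (_ : ∀ t, lam t ≤ CLam * (σε t * √(Real.log (n t) / N t)))
      (_ : ∀ t, lamg t = lam t * √(ν / (2 * maxDeg (G t)) ^ (k + 1)))
      (_ : ∀ t, cMu * √(Real.log (n t) / N t) ≤ mu t)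
      (_ : ∀ t, mu t ≤ CMu * √(Real.log (n t) / N t))
      (βhat : ∀ t, Ω t → Fin (n t) → ℝ) (_ : ∀ t, AEMeasurable (βhat t) (P t))
      (_ : ∀ t, ∀ᵐ ω ∂(P t), objective (G t) k (lamg t) (lam t) (Matrix.of (X t ω))
          (response (Matrix.of (X t ω)) (β t) (ε t ω)) (βhat t ω)
        ≤ objective (G t) k (lamg t) (lam t) (Matrix.of (X t ω))
          (response (Matrix.of (X t ω)) (β t) (ε t ω)) (β t))
      (Θhat : ∀ t, (Fin (N t) → Fin (n t) → ℝ) → Matrix (Fin (n t)) (Fin (n t)) ℝ)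
      (_ : ∀ t a b, Measurable fun x => Θhat t x a b)
      (_ : ∀ t, ∀ᵐ ω ∂(P t), (∃ Θ, ClimeFeasible (Matrix.of (X t ω)) (mu t) Θ) →
        ClimeFeasible (Matrix.of (X t ω)) (mu t) (Θhat t (X t ω)))
      (_ : Tendsto (fun t => s₂ t * Real.log (n t) / √(N t : ℝ)) atTop (𝓝 0))
      (_ : Tendsto (fun t => √(Real.log (n t) / N t)) atTop (𝓝 0))
      (j : ∀ t, Fin (n t)),
      TendstoInDistribution
        (fun t ω => studentized (Matrix.of (X t ω))
          (response (Matrix.of (X t ω)) (β t) (ε t ω)) (Θhat t (X t ω)) (βhat t ω) (β t) (j t))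
        atTop (id : ℝ → ℝ) P (gaussianReal 0 1) := by
  obtain ⟨c, hc, hσc, hσκ⟩ := exists_pos_sq_le σx cmin
  refine ⟨2 * (√(2 * cmax) * 2), by positivity, climeConst c, climeConst_pos hc, ?_⟩
  intro CLam CMu k ν hν N n hN hn G s₁ s₂ hs β hβ Ω _ P _ X ε Sx σε hσ hX hspec hε hind lam lamg mu
    hlam hlam' hlamg hmu hmu' βhat hβm hβhat Θhat hΘm hΘ hsparse hr j
  have hNpos : ∀ᶠ t in atTop, 0 < N t := hN.eventually_gt_atTop 0
  refine tendstoInDistribution_of_measureReal_abs_sub_le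
    (fun t => aemeasurable_studentized_response (hX t).measurable (hε t).aemeasurable (hΘm t)
      (hβm t) (β t) (j t))
    (tendstoInDistribution_of_eventually_hasLaw
      (fun t => aemeasurable_leadingTerm (hσ t) (hX t).measurable (hε t) (hind t) (hΘm t) (j t))
      (hNpos.mono fun t ht =>
        hasLaw_leadingTerm ht (hσ t) (hX t).measurable (hε t) (hind t) (hΘm t) (j t)))
    fun e he δ hδ => ?_
  obtain ⟨q, hq, hqδ⟩ := exists_nonneg_mul_exp_neg_le hδ
  obtain ⟨η, hη, hη', hηe⟩ := exists_pos_lt_mul_lt (a := √(2 * q)) one_half_pos he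
  have hη32 : η ≤ 32 * √2 := by linarith [Real.one_lt_sqrt_two]
  have hκ := tendsto_adjustedSparsity (fun t => (j t).pos) hN hsparse q
  filter_upwards [hNpos, eventually_isSmallRate CLam CMu hcmin hcmax hc hη hη' hηe
    (tendsto_natCast_atTop_atTop.comp hN) hr hκ] with t ht hrate
  have hM : IsTunedModel (N t) (G t) k ν cmin cmax CLam CMu (s₁ t) (s₂ t) (β t) (Sx t) (σε t)
      (lam t) (lamg t) (mu t) :=
    ⟨ht, hn t, hσ t, hcmin, hcmax, hν, hs t, hβ t, (hX t).isHermitian ht, hspec t, hlam t, hlam' t,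
      hlamg t, hmu' t⟩
  exact (hM.measureReal_abs_studentized_sub_leadingTerm_ge_le (hX t) (hε t) (hind t) hc hσc hσκ
    (hmu t) (hΘm t) (hΘ t) (hβhat t) hq hη.le hη32 hrate (j t)).trans hqδ

theorem corollary3 (σx cmin cmax : ℝ) (hσx : 0 < σx) (hcmin : 0 < cmin) (hcmax : 0 < cmax) :
    -- thresholds for the constants in the tuning parameters
    ∃ cLam > (0 : ℝ), ∃ cMu > (0 : ℝ), ∀ (CLam CMu : ℝ)
      -- fixed order `k` and constant `ν`
      (k : ℕ) (ν : ℝ) (_ : 0 ≤ ν) (_ : ν < 1)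
      -- a sequence of problems: sample sizes, dimensions, graphs, sparsity levels
      (N n : ℕ → ℕ) (_ : Tendsto N atTop atTop) (_ : ∀ t, 2 ≤ n t)
      (G : ∀ t, SimpleGraph (Fin (n t)))
      (s₁ s₂ M : ℕ → ℝ) (_ : ∀ t, 0 < s₁ t) (_ : ∀ t, 0 < s₂ t) (_ : ∀ t, ν ≤ s₂ t / s₁ t)
      (β : ∀ t, Fin (n t) → ℝ) (_ : ∀ t, β t ∈ paramSpace (G t) k (s₁ t) (s₂ t))
      -- the random design and the Gaussian noise
      (Ω : ℕ → Type*) [∀ t, MeasurableSpace (Ω t)] (P : ∀ t, Measure (Ω t))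
      [∀ t, IsProbabilityMeasure (P t)]
      (X : ∀ t, Ω t → Fin (N t) → Fin (n t) → ℝ) (ε : ∀ t, Ω t → Fin (N t) → ℝ)
      (Sx : ∀ t, Matrix (Fin (n t)) (Fin (n t)) ℝ) (σε : ℕ → ℝ) (_ : ∀ t, 0 < σε t)
      (_ : ∀ t, IsSubGaussianDesign σx (Sx t) (X t) (P t))
      (_ : ∀ t, spectrum ℝ (Sx t) ⊆ Set.Icc cmin cmax)
      (_ : ∀ t a, ∑ b, |(Sx t)⁻¹ a b| ≤ M t)
      (_ : ∀ t, IsGaussianNoise (σε t) (ε t) (P t))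
      (_ : ∀ t, IndepFun (X t) (ε t) (P t))
      -- the tuning parameters
      (lam lamg mu : ℕ → ℝ)
      (_ : ∀ t, cLam * (σε t * √(Real.log (n t) / N t)) ≤ lam t)
      (_ : ∀ t, lam t ≤ CLam * (σε t * √(Real.log (n t) / N t)))
      (_ : ∀ t, lamg t = lam t * √(ν / (2 * maxDeg (G t)) ^ (k + 1)))
      (_ : ∀ t, cMu * √(Real.log (n t) / N t) ≤ mu t)
      (_ : ∀ t, mu t ≤ CMu * √(Real.log (n t) / N t))
      -- the Graph-Piecewise-Polynomial-Lasso
      (βhat : ∀ t, Ω t → Fin (n t) → ℝ) (_ : ∀ t, AEMeasurable (βhat t) (P t))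
      (_ : ∀ t, ∀ᵐ ω ∂(P t), IsGraphLasso (G t) k (lamg t) (lam t) (Matrix.of (X t ω))
        (response (Matrix.of (X t ω)) (β t) (ε t ω)) (βhat t ω))
      -- the CLIME estimator, a measurable function of the design matrix
      (Θhat : ∀ t, (Fin (N t) → Fin (n t) → ℝ) → Matrix (Fin (n t)) (Fin (n t)) ℝ)
      (_ : ∀ t a b, Measurable fun x => Θhat t x a b)
      (_ : ∀ t, ∀ᵐ ω ∂(P t), (∃ Θ, ClimeFeasible (Matrix.of (X t ω)) (mu t) Θ) →
        IsClime (Matrix.of (X t ω)) (mu t) (Θhat t (X t ω)))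
      -- the growth conditions
      (_ : Tendsto (fun t => s₂ t * Real.log (n t) / √(N t : ℝ)) atTop (𝓝 0))
      (_ : Tendsto (fun t => M t * √(Real.log (n t) / N t)) atTop (𝓝 0))
      -- the coordinate
      (j : ∀ t, Fin (n t)),
      TendstoInDistribution
        (fun t ω => studentized (Matrix.of (X t ω))
          (response (Matrix.of (X t ω)) (β t) (ε t ω)) (Θhat t (X t ω)) (βhat t ω) (β t) (j t))
        atTop (id : ℝ → ℝ) P (gaussianReal 0 1) := by
  obtain ⟨cLam, hcLam, cMu, hcMu, h⟩ := corollary3_general σx cmin cmax hcmin hcmax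
  refine ⟨cLam, hcLam, cMu, hcMu, fun CLam CMu k ν hν _ N n hN hn G s₁ s₂ M hs₁ _ hs β hβ Ω _ P _ X
    ε Sx σε hσ hX hspec hrow hε hind lam lamg mu hlam hlam' hlamg hmu hmu' βhat hβm hβhat Θhat hΘm
    hΘ hsparse hM j => ?_⟩
  exact h CLam CMu k ν hν N n hN hn G s₁ s₂ (fun t => (le_div_iff₀ (hs₁ t)).1 (hs t)) β hβ Ω P X ε
    Sx σε hσ hX hspec hε hind lam lamg mu hlam hlam' hlamg hmu hmu' βhat hβm
    (fun t => (hβhat t).mono fun ω hω => hω (β t)) Θhat hΘm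
    (fun t => (hΘ t).mono fun ω hω hfeasible => (hω hfeasible).1) hsparse
    (tendsto_sqrt_log_div_of_sum_abs_inv_le hcmin hcmax
      ((hN.eventually_gt_atTop 0).mono fun t ht => (hX t).isHermitian ht) hspec hrow j hM) j
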